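/- **Theorem (Cut-elimination).** The additive cut rule is eliminable in each of the nested sequent calculi $\mathsf{N}_{\mathrm{I}}$, $\mathsf{N}_{\mathrm{ND}}$ and $\mathsf{N}_{\mathrm{CD}}$ (for propositional intuitionistic logic, and for first-order intuitionistic logic with nested and with constant domains): for $\mathsf{N}\in\{\mathsf{N}_{\mathrm{I}},\mathsf{N}_{\mathrm{ND}},\mathsf{N}_{\mathrm{CD}}\}$, every nested sequent derivable in $\mathsf{N}\cup\{(cut)\}$ is derivable in $\mathsf{N}$. *Formulae.* The propositional formulae are built from denumerably many propositional variables $p$ and $\bot$ with $\lor,\land,\supset$. The first-order formulae are built from atoms $p(x_1,\dots,x_n)$ (denumerably many predicates $p$ of each arity $n\ge 0$; the terms are the variables, of which there are denumerably many) and $\bot$ with $\lor,\land,\supset,\exists x,\forall x$; they are identified up to renaming of bound variables, and $\varphi(y/x)$ is capture-avoiding substitution. An input formula is written $\varphi^\bullet$, an output formula $\varphi^\circ$. *Nested sequents.* A propositional flat sequent is a finite multiset $\Gamma$ of input and output formulae. A first-order flat sequent is a pair $X;\Gamma$ with, in addition, a finite multiset $X$ of variables, its signature. A nested sequent $\Gamma,[\Delta_1]_{w_1},\dots,[\Delta_n]_{w_n}$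 consists of a flat sequent $\Gamma$ and a finite multiset of labelled nested sequents $\Delta_i$, no label occurring twice; equivalently, it is a finite tree of flat sequents (components) with pairwise distinct labels, whose root has a fixed label $w_0$. $\Sigma\{\Gamma_1\}_{w_1}\cdots\{\Gamma_n\}_{w_n}$ denotes a nested sequent in which the data $\Gamma_i$ occurs at the component labelled $w_i$ (the $w_i$ need not be distinct). We write $w\twoheadrightarrow u$ if $u$ is reachable from $w$ in the tree ($w=u$ included). A variable $y$ is *available* for $w$ if it occurs in the signature of some $u$-component with $u\twoheadrightarrow w$. A variable or label is *fresh* if it does not occur in the conclusion of the rule. In the rules below, premises stand to the left of the slash and the conclusion to the right. *$\mathsf{N}_{\mathrm{I}}$* has the rules - $(id)$: $\ /\ \Sigma\{p^\bullet\}_w\{p^\circ\}_u$, if $w\twoheadrightarrow u$; - $(\bot^\bullet)$: $\ /\ \Sigma\{\bot^\bullet\}_w$; - $(\lor^\bullet)$: $\Sigma\{\varphi^\bullet\}_w,\ \Sigma\{\psi^\bullet\}_w\ /\ \Sigma\{\varphi\lor\psi^\bullet\}_w$; - $(\lor^\circ)$: $\Sigma\{\varphi^\circ,\psi^\circ\}_w\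 /\ \Sigma\{\varphi\lor\psi^\circ\}_w$; - $(\land^\bullet)$: $\Sigma\{\varphi^\bullet,\psi^\bullet\}_w\ /\ \Sigma\{\varphi\land\psi^\bullet\}_w$; - $(\land^\circ)$: $\Sigma\{\varphi^\circ\}_w,\ \Sigma\{\psi^\circ\}_w\ /\ \Sigma\{\varphi\land\psi^\circ\}_w$; - $(\supset^\bullet)$: $\Sigma\{\varphi\supset\psi^\bullet\}_w\{\Gamma,\varphi^\circ\}_u,\ \Sigma\{\varphi\supset\psi^\bullet\}_w\{\Gamma,\psi^\bullet\}_u\ /\ \Sigma\{\varphi\supset\psi^\bullet\}_w\{\Gamma\}_u$, if $w\twoheadrightarrow u$; - $(\supset^\circ)$: $\Sigma\{\Gamma,[\varphi^\bullet,\psi^\circ]_u\}_w\ /\ \Sigma\{\Gamma,\varphi\supset\psi^\circ\}_w$, $u$ a fresh label. *$\mathsf{N}_{\mathrm{ND}}$* has these rules on first-order nested sequents (with arbitrary atoms $p(\vec x)$ in $(id)$ and an empty signature in the new component of $(\supset^\circ)$), and - $(ds)$: $\Sigma\{X,\vec x;p(\vec x)^\bullet\}_w\ /\ \Sigma\{X;p(\vec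 x)^\bullet\}_w$; - $(\exists^\bullet)$: $\Sigma\{X,y;\varphi(y/x)^\bullet\}_w\ /\ \Sigma\{X;\exists x\varphi^\bullet\}_w$, $y$ fresh; - $(\exists^\circ_1)$: $\Sigma\{\varphi(y/x)^\circ,\exists x\varphi^\circ\}_w\ /\ \Sigma\{\exists x\varphi^\circ\}_w$, if $y$ is available for $w$; - $(\exists^\circ_2)$: $\Sigma\{X,y;\Gamma\}_w\{\varphi(y/x)^\circ,\exists x\varphi^\circ\}_u\ /\ \Sigma\{X;\Gamma\}_w\{\exists x\varphi^\circ\}_u$, if $w\twoheadrightarrow u$ and $y$ is fresh; - $(\forall^\bullet_1)$: $\Sigma\{\forall x\varphi^\bullet\}_w\{\Gamma,\varphi(y/x)^\bullet\}_u\ /\ \Sigma\{\forall x\varphi^\bullet\}_w\{\Gamma\}_u$, if $w\twoheadrightarrow u$ and $y$ is available for $u$; - $(\forall^\bullet_2)$: $\Sigma\{X,y;\Gamma\}_w\{\forall x\varphi^\bullet\}_u\{\Delta,\varphi(y/x)^\bullet\}_v\ /\ \Sigma\{X;\Gamma\}_w\{\forall x\varphi^\bullet\}_u\{\Delta\}_v$,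 if $w\twoheadrightarrow u\twoheadrightarrow v$ and $y$ is fresh; - $(\forall^\circ)$: $\Sigma\{\Gamma,[y;\varphi(y/x)^\circ]_u\}_w\ /\ \Sigma\{\Gamma,\forall x\varphi^\circ\}_w$, $u$ a fresh label and $y$ a fresh variable. *$\mathsf{N}_{\mathrm{CD}}$* has the same rules, except that $y$ may be any variable in $(\exists^\circ_1)$ and $(\forall^\bullet_1)$ (which keeps $w\twoheadrightarrow u$), that $(\exists^\circ_2)$ only requires $y$ fresh, and that $(\forall^\bullet_2)$ only requires $u\twoheadrightarrow v$ and $y$ fresh. *Cut.* $(cut)$: $\Sigma\{\Gamma,\varphi^\circ\}_w,\ \Sigma\{\Gamma,\varphi^\bullet\}_w\ /\ \Sigma\{\Gamma\}_w$, for every formula $\varphi$ of the language. -/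

import Mathlib

/-! ## Derivability from a set of inference rules, and eliminability of a rule -/

/-- A set of inference rules on sequents of type `S`, given by its instances:
`R Ps C` says that `C` may be inferred from the list of premises `Ps`. -/
abbrev RuleSet (S : Type) : Type := List S → S → Prop

/-- Derivability: finite trees of rule instances whose leaves are premise-free instances. -/
inductive Derivable {S : Type} (R : RuleSet S) : S → Prop
  | step {Ps : List S} {C : S} (rule : R Ps C) (prems : ∀ P ∈ Ps, Derivable R P) :
      Derivable R C

/-- The calculus `N` extended with the rule `r`. -/
def RuleSet.extend {S : Type} (N r : RuleSet S) : RuleSet S :=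
  fun Ps C => N Ps C ∨ r Ps C

/-- The rule `r` is eliminable in the calculus `N`: whatever can be derived in `N` extended
with `r` can be derived in `N` alone. -/
def Eliminable {S : Type} (r N : RuleSet S) : Prop :=
  ∀ C : S, Derivable (N.extend r) C → Derivable N C

/-! ## Nested sequents -/

/-- Polarized formulae: `inp φ` is the input formula `φ•`, `out φ` the output formula `φ°`. -/
inductive Pol (F : Type) : Type
  | inp (φ : F)
  | out (φ : F)

/-- A nested sequent `Γ, [Δ₁]_{w₁}, …, [Δₙ]_{wₙ}`. Every label occurs only once in a nested
sequent and the order of its nestings is immaterial, so it is the same thing as its finite tree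
of labelled components, with root label `0`. The flat sequent at the label `w` is `comp w`, of
type `D` (values of `comp` outside `labels` carry no meaning and are never inspected). -/
structure NSeq (D : Type) where
  labels : Finset ℕ
  edges : Finset (ℕ × ℕ)
  comp : ℕ → D
  root_mem : 0 ∈ labels
  edge_mem : ∀ w u, (w, u) ∈ edges → w ∈ labels ∧ u ∈ labels
  root_no_parent : ∀ w, (w, 0) ∉ edges
  parent_unique : ∀ w v u, (w, u) ∈ edges → (v, u) ∈ edges → w = v
  root_reaches : ∀ u ∈ labels, Relation.ReflTransGen (fun a b => (a, b) ∈ edges) 0 u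

namespace NSeq

variable {D : Type}

/-- The label `u` is reachable from the label `w`. -/
def Reach (S : NSeq D) (w u : ℕ) : Prop :=
  w ∈ S.labels ∧ u ∈ S.labels ∧ Relation.ReflTransGen (fun a b => (a, b) ∈ S.edges) w u

/-- `S.put w d` is `S{d}_w`: the data `d` is joined to the `w`-component of `S`. -/
def put [AddCommMonoid D] (S : NSeq D) (w : ℕ) (d : D) : NSeq D :=
  { S with comp := S.comp + Pi.single w d }

/-- `S.nest w u _ _ d` is `S{[d]_u}_w`: a new child component `d`, with a label `u` that does
not occur in `S`, is put below the `w`-component of `S`. -/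
def nest (S : NSeq D) (w u : ℕ) (hw : w ∈ S.labels) (hu : u ∉ S.labels) (d : D) : NSeq D where
  labels := insert u S.labels
  edges := insert (w, u) S.edges
  comp := Function.update S.comp u d
  root_mem := Finset.mem_insert_of_mem S.root_mem
  edge_mem := by
    intro a b h
    rcases Finset.mem_insert.1 h with h | h
    · obtain ⟨rfl, rfl⟩ := Prod.mk.inj h
      exact ⟨Finset.mem_insert_of_mem hw, Finset.mem_insert_self _ _⟩
    · exact ⟨Finset.mem_insert_of_mem (S.edge_mem a b h).1,
        Finset.mem_insert_of_mem (S.edge_mem a b h).2⟩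
  root_no_parent := by
    intro a h
    rcases Finset.mem_insert.1 h with h | h
    · obtain ⟨_, h0⟩ := Prod.mk.inj h
      exact hu (h0 ▸ S.root_mem)
    · exact S.root_no_parent a h
  parent_unique := by
    intro a b c ha hb
    rcases Finset.mem_insert.1 ha with ha | ha <;> rcases Finset.mem_insert.1 hb with hb | hb
    · rw [(Prod.mk.inj ha).1, (Prod.mk.inj hb).1]
    · exact absurd ((Prod.mk.inj ha).2 ▸ (S.edge_mem b c hb).2) hu
    · exact absurd ((Prod.mk.inj hb).2 ▸ (S.edge_mem a c ha).2) hu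
    · exact S.parent_unique a b c ha hb
  root_reaches := by
    have old : ∀ v ∈ S.labels,
        Relation.ReflTransGen (fun a b => (a, b) ∈ insert (w, u) S.edges) 0 v :=
      fun v hv => Relation.ReflTransGen.mono (fun _ _ h => Finset.mem_insert_of_mem h) _ _ (S.root_reaches v hv)
    intro v hv
    rcases Finset.mem_insert.1 hv with rfl | hv
    · exact (old w hw).tail (Finset.mem_insert_self _ _)
    · exact old v hv

end NSeq

/-! ## The propositional calculus `N_I` -/

/-- The propositional language, over denumerably many propositional variables. -/
inductive PForm : Type
  | atom (p : ℕ)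
  | bot
  | or (φ ψ : PForm)
  | and (φ ψ : PForm)
  | imp (φ ψ : PForm)

/-- Propositional nested sequents: components are multisets of polarized formulae. -/
abbrev PSeq : Type := NSeq (Multiset (Pol PForm))

open Pol in
/-- The nested calculus `N_I`. -/
inductive NI : RuleSet PSeq
  | id (S : PSeq) {w u : ℕ} (hwu : S.Reach w u) (p : ℕ) :
      NI [] ((S.put w {inp (.atom p)}).put u {out (.atom p)})
  | botIn (S : PSeq) {w : ℕ} (hw : w ∈ S.labels) :
      NI [] (S.put w {inp .bot})
  | orIn (S : PSeq) {w : ℕ} (hw : w ∈ S.labels) (φ ψ : PForm) :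
      NI [S.put w {inp φ}, S.put w {inp ψ}] (S.put w {inp (.or φ ψ)})
  | orOut (S : PSeq) {w : ℕ} (hw : w ∈ S.labels) (φ ψ : PForm) :
      NI [S.put w {out φ, out ψ}] (S.put w {out (.or φ ψ)})
  | andIn (S : PSeq) {w : ℕ} (hw : w ∈ S.labels) (φ ψ : PForm) :
      NI [S.put w {inp φ, inp ψ}] (S.put w {inp (.and φ ψ)})
  | andOut (S : PSeq) {w : ℕ} (hw : w ∈ S.labels) (φ ψ : PForm) :
      NI [S.put w {out φ}, S.put w {out ψ}] (S.put w {out (.and φ ψ)})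
  | impIn (S : PSeq) {w u : ℕ} (hwu : S.Reach w u) (φ ψ : PForm) :
      NI [(S.put w {inp (.imp φ ψ)}).put u {out φ}, (S.put w {inp (.imp φ ψ)}).put u {inp ψ}]
        (S.put w {inp (.imp φ ψ)})
  | impOut (S : PSeq) {w u : ℕ} (hw : w ∈ S.labels) (hu : u ∉ S.labels) (φ ψ : PForm) :
      NI [S.nest w u hw hu {inp φ, out ψ}] (S.put w {out (.imp φ ψ)})

open Pol in
/-- The additive cut rule on propositional nested sequents. -/
inductive CutI : RuleSet PSeq
  | cut (S : PSeq) {w : ℕ} (hw : w ∈ S.labels) (φ : PForm) :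
      CutI [S.put w {out φ}, S.put w {inp φ}] S

/-! ## The first-order calculi `N_ND` and `N_CD` -/

/-- First-order formulae up to renaming of bound variables. Free variables are the elements of
`Var = ℕ`; `QForm n` holds the formulae in the scope of `n` further quantifiers, the `i`-th of
which, counted from the outside, binds the variable `Sum.inr i`. The atoms of arity `k` are
built from the denumerably many `k`-ary predicates `p : ℕ`. The language itself is `QForm 0`. -/
inductive QForm : ℕ → Type
  | atom {n k : ℕ} (p : ℕ) (x : Fin k → ℕ ⊕ Fin n) : QForm n
  | bot {n : ℕ} : QForm n
  | or {n : ℕ} (φ ψ : QForm n) : QForm n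
  | and {n : ℕ} (φ ψ : QForm n) : QForm n
  | imp {n : ℕ} (φ ψ : QForm n) : QForm n
  | ex {n : ℕ} (φ : QForm (n + 1)) : QForm n
  | all {n : ℕ} (φ : QForm (n + 1)) : QForm n

namespace QForm

/-- Substitution of the free variable `y` for the outermost bound variable: when `∃xφ` or `∀xφ`
is `ex φ` or `all φ`, the formula `φ(y/x)` is `φ.inst y`. -/
def inst (y : ℕ) : {n : ℕ} → QForm (n + 1) → QForm n
  | _, atom p x => atom p fun i => Sum.elim Sum.inl (Fin.cases (Sum.inl y) Sum.inr) (x i)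
  | _, bot => bot
  | _, or φ ψ => or (inst y φ) (inst y ψ)
  | _, and φ ψ => and (inst y φ) (inst y ψ)
  | _, imp φ ψ => imp (inst y φ) (inst y ψ)
  | _, ex φ => ex (inst y φ)
  | _, all φ => all (inst y φ)

/-- The variable `y` occurs (free) in a formula. -/
def Occurs (y : ℕ) : {n : ℕ} → QForm n → Prop
  | _, atom _ x => ∃ i, x i = Sum.inl y
  | _, bot => False
  | _, or φ ψ => Occurs y φ ∨ Occurs y ψ
  | _, and φ ψ => Occurs y φ ∨ Occurs y ψ
  | _, imp φ ψ => Occurs y φ ∨ Occurs y ψ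
  | _, ex φ => Occurs y φ
  | _, all φ => Occurs y φ

/-- The atomic formula `p(x₁, …, x_k)` of the language. -/
def pred {k : ℕ} (p : ℕ) (x : Fin k → ℕ) : QForm 0 := atom p fun i => Sum.inl (x i)

end QForm

/-- First-order nested sequents: a component `X; Γ` is a signature (a multiset of variables)
together with a multiset of polarized formulae. -/
abbrev QSeq : Type := NSeq (Multiset ℕ × Multiset (Pol (QForm 0)))

namespace QSeq

/-- The variable `y` is available for the label `w`. -/
def Available (S : QSeq) (y w : ℕ) : Prop :=
  ∃ u, S.Reach u w ∧ y ∈ (S.comp u).1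

/-- The variable `y` does not occur in `S`, neither in a signature nor in a formula. -/
def Fresh (S : QSeq) (y : ℕ) : Prop :=
  ∀ w ∈ S.labels, y ∉ (S.comp w).1 ∧
    ∀ φ : QForm 0, (Pol.inp φ ∈ (S.comp w).2 ∨ Pol.out φ ∈ (S.comp w).2) → ¬ φ.Occurs y

end QSeq

/-- The two kinds of side conditions: nested domains and constant domains. -/
inductive Dom : Type
  | ND
  | CD

open Pol in
/-- The nested calculi `N_ND = NQ .ND` and `N_CD = NQ .CD`. The side conditions are guarded by
`L = .ND` where they are imposed in `N_ND` only. -/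
inductive NQ (L : Dom) : RuleSet QSeq
  | id (S : QSeq) {w u : ℕ} (hwu : S.Reach w u) {k : ℕ} (p : ℕ) (x : Fin k → ℕ) :
      NQ L [] ((S.put w (0, {inp (.pred p x)})).put u (0, {out (.pred p x)}))
  | botIn (S : QSeq) {w : ℕ} (hw : w ∈ S.labels) :
      NQ L [] (S.put w (0, {inp .bot}))
  | ds (S : QSeq) {w : ℕ} (hw : w ∈ S.labels) {k : ℕ} (p : ℕ) (x : Fin k → ℕ) :
      NQ L [S.put w (Multiset.ofList (List.ofFn x), {inp (.pred p x)})]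
        (S.put w (0, {inp (.pred p x)}))
  | orIn (S : QSeq) {w : ℕ} (hw : w ∈ S.labels) (φ ψ : QForm 0) :
      NQ L [S.put w (0, {inp φ}), S.put w (0, {inp ψ})] (S.put w (0, {inp (.or φ ψ)}))
  | orOut (S : QSeq) {w : ℕ} (hw : w ∈ S.labels) (φ ψ : QForm 0) :
      NQ L [S.put w (0, {out φ, out ψ})] (S.put w (0, {out (.or φ ψ)}))
  | andIn (S : QSeq) {w : ℕ} (hw : w ∈ S.labels) (φ ψ : QForm 0) :
      NQ L [S.put w (0, {inp φ, inp ψ})] (S.put w (0, {inp (.and φ ψ)}))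
  | andOut (S : QSeq) {w : ℕ} (hw : w ∈ S.labels) (φ ψ : QForm 0) :
      NQ L [S.put w (0, {out φ}), S.put w (0, {out ψ})] (S.put w (0, {out (.and φ ψ)}))
  | impIn (S : QSeq) {w u : ℕ} (hwu : S.Reach w u) (φ ψ : QForm 0) :
      NQ L [(S.put w (0, {inp (.imp φ ψ)})).put u (0, {out φ}),
          (S.put w (0, {inp (.imp φ ψ)})).put u (0, {inp ψ})]
        (S.put w (0, {inp (.imp φ ψ)}))
  | impOut (S : QSeq) {w u : ℕ} (hw : w ∈ S.labels) (hu : u ∉ S.labels) (φ ψ : QForm 0) :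
      NQ L [S.nest w u hw hu (0, {inp φ, out ψ})] (S.put w (0, {out (.imp φ ψ)}))
  | exIn (S : QSeq) {w : ℕ} (hw : w ∈ S.labels) (φ : QForm 1) (y : ℕ)
      (hy : QSeq.Fresh (S.put w (0, {inp (.ex φ)})) y) :
      NQ L [S.put w ({y}, {inp (φ.inst y)})] (S.put w (0, {inp (.ex φ)}))
  | exOut₁ (S : QSeq) {w : ℕ} (hw : w ∈ S.labels) (φ : QForm 1) (y : ℕ)
      (hy : L = .ND → QSeq.Available S y w) :
      NQ L [S.put w (0, {out (φ.inst y), out (.ex φ)})] (S.put w (0, {out (.ex φ)}))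
  | exOut₂ (S : QSeq) {w u : ℕ} (hw : w ∈ S.labels) (hu : u ∈ S.labels) (φ : QForm 1) (y : ℕ)
      (hwu : L = .ND → S.Reach w u)
      (hy : QSeq.Fresh (S.put u (0, {out (.ex φ)})) y) :
      NQ L [(S.put w ({y}, 0)).put u (0, {out (φ.inst y), out (.ex φ)})]
        (S.put u (0, {out (.ex φ)}))
  | allIn₁ (S : QSeq) {w u : ℕ} (hwu : S.Reach w u) (φ : QForm 1) (y : ℕ)
      (hy : L = .ND → QSeq.Available S y u) :
      NQ L [(S.put w (0, {inp (.all φ)})).put u (0, {inp (φ.inst y)})]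
        (S.put w (0, {inp (.all φ)}))
  | allIn₂ (S : QSeq) {w u v : ℕ} (hw : w ∈ S.labels) (huv : S.Reach u v) (φ : QForm 1) (y : ℕ)
      (hwu : L = .ND → S.Reach w u)
      (hy : QSeq.Fresh (S.put u (0, {inp (.all φ)})) y) :
      NQ L [((S.put w ({y}, 0)).put u (0, {inp (.all φ)})).put v (0, {inp (φ.inst y)})]
        (S.put u (0, {inp (.all φ)}))
  | allOut (S : QSeq) {w u : ℕ} (hw : w ∈ S.labels) (hu : u ∉ S.labels) (φ : QForm 1) (y : ℕ)
      (hy : QSeq.Fresh (S.put w (0, {out (.all φ)})) y) :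
      NQ L [S.nest w u hw hu ({y}, {out (φ.inst y)})] (S.put w (0, {out (.all φ)}))

open Pol in
/-- The additive cut rule on first-order nested sequents. -/
inductive CutQ : RuleSet QSeq
  | cut (S : QSeq) {w : ℕ} (hw : w ∈ S.labels) (φ : QForm 0) :
      CutQ [S.put w (0, {out φ}), S.put w (0, {inp φ})] S

/-!
# Eliminability of the cut rule in nested sequent calculi

The proof is semantic. For the first-order calculi, every rule, and the cut rule as well, is sound
for Kripke models with nonempty growing (or constant) domains: `KModel.exists_falsifies_premise`
pushes a falsifying interpretation from the conclusion of a rule instance to one of its premises.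
Free variables may denote any element of the universe of the model, while a variable in a signature
has to denote an element of the domain of its world; the rule `ds` is sound because atoms hold only
of elements of the domain.

Conversely, a sequent without a cut-free derivation is falsified by some model
(`FairRun.falsifies_model`). Applying the rules backwards never gets stuck on derivable sequents
(`exists_reduced`), so there is an infinite chain of underivable sequents in which each formula
occurrence is treated, and those that the rules keep are treated infinitely often with all
parameters (`exists_fairRun`). The union of the trees along the chain is the countermodel: its
worlds are the labels, its domains consist of the available variables, and an input atom holds from
the label where it occurs upwards. As only one chain of premises is followed, neither weakening nor
contraction nor invertibility of the rules is needed. A root signature that stays empty means that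
no rule ever required an element of a domain, and then all variables can be put into every domain.

The propositional calculus is reduced to the first-order one: propositional variables become atoms
of arity zero (`derivable_embed`), and a cut-free derivation of a quantifier-free sequent consists
of propositional inferences and harmless instances of `ds` (`derivable_forget`).
-/

/-! ### Nested sequents -/

namespace NSeq

variable {D : Type}

@[simp] theorem labels_put [AddCommMonoid D] (S : NSeq D) (w : ℕ) (d : D) :
    (S.put w d).labels = S.labels := rfl

@[simp] theorem edges_put [AddCommMonoid D] (S : NSeq D) (w : ℕ) (d : D) :
    (S.put w d).edges = S.edges := rfl

@[simp] theorem reach_put [AddCommMonoid D] {S : NSeq D} {w : ℕ} {d : D} {a b : ℕ} :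
    (S.put w d).Reach a b ↔ S.Reach a b := Iff.rfl

@[simp] theorem comp_put_self [AddCommMonoid D] (S : NSeq D) (w : ℕ) (d : D) :
    (S.put w d).comp w = S.comp w + d := by
  simp [put]

theorem comp_put_of_ne [AddCommMonoid D] (S : NSeq D) {w v : ℕ} (d : D) (h : v ≠ w) :
    (S.put w d).comp v = S.comp v := by
  simp [put, Pi.single_eq_of_ne h]

theorem Reach.refl {S : NSeq D} {w : ℕ} (hw : w ∈ S.labels) : S.Reach w w :=
  ⟨hw, hw, .refl⟩

theorem Reach.trans {S : NSeq D} {u v w : ℕ} (h : S.Reach u v) (h' : S.Reach v w) :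
    S.Reach u w :=
  ⟨h.1, h'.2.1, h.2.2.trans h'.2.2⟩

theorem reach_root (S : NSeq D) {w : ℕ} (hw : w ∈ S.labels) : S.Reach 0 w :=
  ⟨S.root_mem, hw, S.root_reaches w hw⟩

end NSeq

namespace QSeq

theorem mem_sig_put {S : QSeq} {w v x : ℕ} {d : Multiset ℕ × Multiset (Pol (QForm 0))} :
    x ∈ ((S.put w d).comp v).1 ↔ x ∈ (S.comp v).1 ∨ v = w ∧ x ∈ d.1 := by
  by_cases h : v = w
  · subst h; simp
  · simp [NSeq.comp_put_of_ne _ _ h, h]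

theorem mem_form_put {S : QSeq} {w v : ℕ} {A : Pol (QForm 0)}
    {d : Multiset ℕ × Multiset (Pol (QForm 0))} :
    A ∈ ((S.put w d).comp v).2 ↔ A ∈ (S.comp v).2 ∨ v = w ∧ A ∈ d.2 := by
  by_cases h : v = w
  · subst h; simp
  · simp [NSeq.comp_put_of_ne _ _ h, h]

/-- An occurrence of a formula can be split off from a sequent. -/
theorem exists_eq_put {S : QSeq} {w : ℕ} {A : Pol (QForm 0)} (h : A ∈ (S.comp w).2) :
    ∃ T : QSeq, S = T.put w (0, {A}) := by
  obtain ⟨Γ, hΓ⟩ := Multiset.exists_cons_of_mem h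
  refine ⟨{ S with comp := Function.update S.comp w ((S.comp w).1, Γ) }, ?_⟩
  obtain ⟨labels, edges, comp⟩ := S
  simp only [NSeq.put, NSeq.mk.injEq, true_and]
  funext v
  by_cases hv : v = w
  · subst hv
    ext1
    · simp
    · simpa [Multiset.add_comm Γ] using hΓ
  · simp [hv]

end QSeq

/-! ### First-order formulae and fresh variables -/

namespace QForm

/-- The number of connectives and quantifiers of a formula. -/
def size : {n : ℕ} → QForm n → ℕ
  | _, atom _ _ => 0
  | _, bot => 0
  | _, or φ ψ => size φ + size ψ + 1
  | _, and φ ψ => size φ + size ψ + 1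
  | _, imp φ ψ => size φ + size ψ + 1
  | _, ex φ => size φ + 1
  | _, all φ => size φ + 1

@[simp] theorem size_inst (y : ℕ) : ∀ {n : ℕ} (φ : QForm (n + 1)), (φ.inst y).size = φ.size
  | _, atom _ _ => by simp [inst, size]
  | _, bot => by simp [inst, size]
  | _, or φ ψ => by simp [inst, size, size_inst y φ, size_inst y ψ]
  | _, and φ ψ => by simp [inst, size, size_inst y φ, size_inst y ψ]
  | _, imp φ ψ => by simp [inst, size, size_inst y φ, size_inst y ψ]
  | _, ex φ => by simp [inst, size, size_inst y φ]
  | _, all φ => by simp [inst, size, size_inst y φ]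

theorem finite_occurs : ∀ {n : ℕ} (φ : QForm n), {y | φ.Occurs y}.Finite
  | _, atom _ x => by
    refine (Set.finite_range fun i => (x i).elim id fun _ => 0).subset ?_
    rintro y ⟨i, hi⟩
    exact ⟨i, by simp [hi]⟩
  | _, bot => by simp [Occurs]
  | _, or φ ψ => (finite_occurs φ).union (finite_occurs ψ)
  | _, and φ ψ => (finite_occurs φ).union (finite_occurs ψ)
  | _, imp φ ψ => (finite_occurs φ).union (finite_occurs ψ)
  | _, ex φ => finite_occurs φ
  | _, all φ => finite_occurs φ

/-- A Gödel numbering of formulae. -/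
def code : {n : ℕ} → QForm n → ℕ
  | _, atom (k := k) p x => Nat.pair 0 (Nat.pair k (Nat.pair p (Encodable.encode x)))
  | _, bot => Nat.pair 1 0
  | _, or φ ψ => Nat.pair 2 (Nat.pair (code φ) (code ψ))
  | _, and φ ψ => Nat.pair 3 (Nat.pair (code φ) (code ψ))
  | _, imp φ ψ => Nat.pair 4 (Nat.pair (code φ) (code ψ))
  | _, ex φ => Nat.pair 5 (code φ)
  | _, all φ => Nat.pair 6 (code φ)

theorem code_injective {n : ℕ} : Function.Injective (code (n := n)) := by
  intro φ
  induction φ with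
  | atom p x =>
    intro ψ h
    cases ψ <;> simp only [code, Nat.pair_eq_pair] at h <;> try omega
    obtain ⟨_, rfl, rfl, h⟩ := h
    rw [Encodable.encode_injective h]
  | bot => intro ψ h; cases ψ <;> simp [code, Nat.pair_eq_pair] at h ⊢
  | or _ _ h₁ h₂ | and _ _ h₁ h₂ | imp _ _ h₁ h₂ =>
    intro ψ h
    cases ψ <;> simp only [code, Nat.pair_eq_pair] at h <;> try omega
    rw [h₁ h.2.1, h₂ h.2.2]
  | ex _ h₁ | all _ h₁ =>
    intro ψ h
    cases ψ <;> simp only [code, Nat.pair_eq_pair] at h <;> try omega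
    rw [h₁ h.2]

instance (n : ℕ) : Countable (QForm n) := code_injective.countable

/-- Every atom of the language is some `p(x₁, …, x_k)`. -/
theorem exists_eq_pred {k : ℕ} (p : ℕ) (x : Fin k → ℕ ⊕ Fin 0) :
    ∃ a : Fin k → ℕ, atom p x = pred p a := by
  refine ⟨fun i => (x i).elim id Fin.elim0, ?_⟩
  unfold pred
  congr 1
  funext i
  rcases h : x i with y | j
  · simp [h]
  · exact j.elim0

end QForm

theorem QSeq.exists_fresh (S : QSeq) : ∃ y, S.Fresh y := by
  classical
  have hform : ∀ Γ : Multiset (Pol (QForm 0)), {y | ∃ φ : QForm 0,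
      (Pol.inp φ ∈ Γ ∨ Pol.out φ ∈ Γ) ∧ φ.Occurs y}.Finite := by
    intro Γ
    have : ∀ A : Pol (QForm 0), {y | ∃ φ : QForm 0,
        (Pol.inp φ = A ∨ Pol.out φ = A) ∧ φ.Occurs y}.Finite := by
      rintro (φ | φ) <;> simpa using φ.finite_occurs
    refine (Set.Finite.biUnion Γ.toFinset.finite_toSet fun A _ => this A).subset ?_
    rintro y ⟨φ, h | h, hy⟩
    · exact Set.mem_biUnion (by simpa using h) ⟨φ, .inl rfl, hy⟩
    · exact Set.mem_biUnion (by simpa using h) ⟨φ, .inr rfl, hy⟩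
  have hfin : (⋃ w ∈ S.labels, ({y | y ∈ (S.comp w).1} ∪ {y | ∃ φ : QForm 0,
      (Pol.inp φ ∈ (S.comp w).2 ∨ Pol.out φ ∈ (S.comp w).2) ∧ φ.Occurs y})).Finite := by
    refine Set.Finite.biUnion S.labels.finite_toSet fun w _ => .union ?_ (hform _)
    exact (S.comp w).1.toFinset.finite_toSet.subset fun y hy => by simpa using hy
  obtain ⟨y, hy⟩ := hfin.exists_notMem
  refine ⟨y, fun w hw => ?_⟩
  simp only [Set.mem_iUnion, not_exists] at hy
  have := hy w hw
  simp only [Set.mem_union, Set.mem_ofPred_eq, not_or, not_exists, not_and] at this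
  exact ⟨this.1, this.2⟩

/-! ### Kripke models and soundness -/

/-- A first-order Kripke model. The domains grow along the accessibility relation, are nonempty,
and live inside one universe; variables may denote any element of the universe, but an atom
holds at a world only of elements of the domain of that world. -/
structure KModel where
  World : Type
  rel : World → World → Prop
  rel_refl : ∀ w, rel w w
  rel_trans : ∀ {u v w}, rel u v → rel v w → rel u w
  U : Type
  dom : World → Set U
  dom_nonempty : ∀ w, (dom w).Nonempty
  dom_mono : ∀ {w v}, rel w v → dom w ⊆ dom v
  val : World → ℕ → {k : ℕ} → (Fin k → U) → Prop
  val_mono : ∀ {w v}, rel w v → ∀ {p k} {a : Fin k → U}, val w p a → val v p a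
  val_dom : ∀ {w p k} {a : Fin k → U}, val w p a → ∀ i, a i ∈ dom w

namespace KModel

variable (M : KModel)

/-- `M.Force σ φ ρ w`: the world `w` forces `φ`, where `σ` assigns values to the free variables
and `ρ` to the variables bound by the quantifiers that `φ` is in the scope of. -/
def Force (σ : ℕ → M.U) : {n : ℕ} → QForm n → (Fin n → M.U) → M.World → Prop
  | _, .atom p x, ρ, w => M.val w p fun i => Sum.elim σ ρ (x i)
  | _, .bot, _, _ => False
  | _, .or φ ψ, ρ, w => Force σ φ ρ w ∨ Force σ ψ ρ w
  | _, .and φ ψ, ρ, w => Force σ φ ρ w ∧ Force σ ψ ρ w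
  | _, .imp φ ψ, ρ, w => ∀ v, M.rel w v → Force σ φ ρ v → Force σ ψ ρ v
  | n, .ex φ, ρ, w => ∃ a ∈ M.dom w, Force σ φ (Fin.snoc (α := fun _ : Fin (n + 1) => M.U) ρ a) w
  | n, .all φ, ρ, w => ∀ v, M.rel w v → ∀ a ∈ M.dom v,
      Force σ φ (Fin.snoc (α := fun _ : Fin (n + 1) => M.U) ρ a) v

variable {M}

theorem force_inst {σ : ℕ → M.U} (y : ℕ) : ∀ {n : ℕ} (φ : QForm (n + 1)) (ρ : Fin n → M.U)
    (w : M.World), M.Force σ (φ.inst y) ρ w ↔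
      M.Force σ φ (Fin.cons (α := fun _ : Fin (n + 1) => M.U) (σ y) ρ) w
  | _, .atom p x, ρ, w => by
    simp only [QForm.inst, Force]
    refine iff_of_eq (congrArg _ (funext fun i => ?_))
    rcases x i with v | j
    · rfl
    · refine Fin.cases ?_ (fun j => ?_) j <;> rfl
  | _, .bot, _, _ => by simp only [QForm.inst, Force]
  | _, .or φ ψ, ρ, w => by simp only [QForm.inst, Force, force_inst y φ, force_inst y ψ]
  | _, .and φ ψ, ρ, w => by simp only [QForm.inst, Force, force_inst y φ, force_inst y ψ]
  | _, .imp φ ψ, ρ, w => by simp only [QForm.inst, Force, force_inst y φ, force_inst y ψ]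
  | _, .ex φ, ρ, w => by
    simp only [QForm.inst, Force, ← Fin.cons_snoc_eq_snoc_cons]
    exact exists_congr fun a => and_congr_right fun _ => force_inst y φ _ w
  | _, .all φ, ρ, w => by
    simp only [QForm.inst, Force, ← Fin.cons_snoc_eq_snoc_cons]
    exact forall_congr' fun v => forall_congr' fun _ => forall_congr' fun a =>
      forall_congr' fun _ => force_inst y φ _ v

theorem force_inst_iff_snoc {σ : ℕ → M.U} {y : ℕ} {φ : QForm 1} {ρ : Fin 0 → M.U}
    {w : M.World} : M.Force σ (φ.inst y) ρ w ↔
      M.Force σ φ (Fin.snoc (α := fun _ : Fin 1 => M.U) ρ (σ y)) w := by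
  rw [force_inst]
  refine iff_of_eq (congrArg (fun r => M.Force σ φ r w) (funext fun i => ?_))
  rw [Fin.fin_one_eq_zero i]
  rfl

theorem force_congr {σ τ : ℕ → M.U} : ∀ {n : ℕ} (φ : QForm n) (_ : ∀ y, φ.Occurs y → σ y = τ y)
    (ρ : Fin n → M.U) (w : M.World), M.Force σ φ ρ w ↔ M.Force τ φ ρ w
  | _, .atom p x, h, ρ, w => by
    simp only [Force]
    refine iff_of_eq (congrArg _ (funext fun i => ?_))
    rcases hx : x i with v | j
    · exact h v ⟨i, hx⟩
    · rfl
  | _, .bot, _, _, _ => Iff.rfl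
  | _, .or φ ψ, h, ρ, w => or_congr (force_congr φ (fun y hy => h y (.inl hy)) ρ w)
      (force_congr ψ (fun y hy => h y (.inr hy)) ρ w)
  | _, .and φ ψ, h, ρ, w => and_congr (force_congr φ (fun y hy => h y (.inl hy)) ρ w)
      (force_congr ψ (fun y hy => h y (.inr hy)) ρ w)
  | _, .imp φ ψ, h, ρ, w => forall_congr' fun v => forall_congr' fun _ =>
      imp_congr (force_congr φ (fun y hy => h y (.inl hy)) ρ v)
        (force_congr ψ (fun y hy => h y (.inr hy)) ρ v)
  | _, .ex φ, h, ρ, w => exists_congr fun a => and_congr_right fun _ => force_congr φ h _ w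
  | _, .all φ, h, ρ, w => forall_congr' fun v => forall_congr' fun _ => forall_congr' fun a =>
      forall_congr' fun _ => force_congr φ h _ v

variable (M) in
/-- The world `v` refutes the flat sequent `d`: it contains the values of the signature, forces
the input formulae and does not force the output formulae. -/
def Refutes (σ : ℕ → M.U) (v : M.World) (d : Multiset ℕ × Multiset (Pol (QForm 0))) : Prop :=
  (∀ x ∈ d.1, σ x ∈ M.dom v) ∧ (∀ φ, Pol.inp φ ∈ d.2 → M.Force σ φ Fin.elim0 v) ∧
    ∀ φ, Pol.out φ ∈ d.2 → ¬ M.Force σ φ Fin.elim0 v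

variable (M) in
/-- The interpretation `f` of the labels as worlds, with the assignment `σ`, falsifies the nested
sequent `S`: it preserves the tree structure and each component is refuted at its world. -/
def Falsifies (f : ℕ → M.World) (σ : ℕ → M.U) (S : QSeq) : Prop :=
  (∀ a b, (a, b) ∈ S.edges → M.rel (f a) (f b)) ∧ ∀ w ∈ S.labels, M.Refutes σ (f w) (S.comp w)

theorem refutes_add {σ : ℕ → M.U} {v : M.World} {d e : Multiset ℕ × Multiset (Pol (QForm 0))} :
    M.Refutes σ v (d + e) ↔ M.Refutes σ v d ∧ M.Refutes σ v e := by
  simp only [Refutes, Prod.fst_add, Prod.snd_add, Multiset.mem_add, or_imp, forall_and]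
  tauto

theorem falsifies_put {f : ℕ → M.World} {σ : ℕ → M.U} {S : QSeq} {w : ℕ} (hw : w ∈ S.labels)
    {d : Multiset ℕ × Multiset (Pol (QForm 0))} :
    M.Falsifies f σ (S.put w d) ↔ M.Falsifies f σ S ∧ M.Refutes σ (f w) d := by
  constructor
  · rintro ⟨h₁, h₂⟩
    refine ⟨⟨h₁, fun v hv => ?_⟩, ?_⟩
    · by_cases h : v = w
      · subst h
        have := h₂ v hv
        rw [NSeq.comp_put_self, refutes_add] at this
        exact this.1
      · simpa [NSeq.comp_put_of_ne _ _ h] using h₂ v hv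
    · have := h₂ w hw
      rw [NSeq.comp_put_self, refutes_add] at this
      exact this.2
  · rintro ⟨⟨h₁, h₂⟩, h₃⟩
    refine ⟨h₁, fun v hv => ?_⟩
    by_cases h : v = w
    · subst h
      rw [NSeq.comp_put_self, refutes_add]
      exact ⟨h₂ v hv, h₃⟩
    · simpa [NSeq.comp_put_of_ne _ _ h] using h₂ v hv

theorem Falsifies.nest {f : ℕ → M.World} {σ : ℕ → M.U} {S : QSeq} (h : M.Falsifies f σ S)
    {w u : ℕ} (hw : w ∈ S.labels) (hu : u ∉ S.labels)
    {d : Multiset ℕ × Multiset (Pol (QForm 0))} {v : M.World} (hv : M.rel (f w) v)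
    (hd : M.Refutes σ v d) : M.Falsifies (Function.update f u v) σ (S.nest w u hw hu d) := by
  have hf : ∀ a ∈ S.labels, Function.update f u v a = f a := fun a ha =>
    Function.update_of_ne (fun e : a = u => hu (e ▸ ha)) _ _
  refine ⟨fun a b hab => ?_, fun a ha => ?_⟩
  · rcases Finset.mem_insert.1 hab with hab | hab
    · obtain ⟨rfl, rfl⟩ := Prod.mk.inj hab
      rwa [hf _ hw, Function.update_self]
    · rw [hf _ (S.edge_mem a b hab).1, hf _ (S.edge_mem a b hab).2]
      exact h.1 a b hab
  · rcases Finset.mem_insert.1 ha with rfl | ha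
    · simpa [NSeq.nest] using hd
    · have hne : a ≠ u := fun e => hu (e ▸ ha)
      simpa [NSeq.nest, hne] using h.2 a ha

theorem Falsifies.rel_of_reach {f : ℕ → M.World} {σ : ℕ → M.U} {S : QSeq}
    (h : M.Falsifies f σ S) {w u : ℕ} (hwu : S.Reach w u) : M.rel (f w) (f u) := by
  obtain ⟨-, -, hwu⟩ := hwu
  induction hwu with
  | refl => exact M.rel_refl _
  | tail _ hbc ih => exact M.rel_trans ih (h.1 _ _ hbc)

theorem Falsifies.update {f : ℕ → M.World} {σ : ℕ → M.U} {S : QSeq}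
    (h : M.Falsifies f σ S) {y : ℕ} (hy : S.Fresh y) (a : M.U) :
    M.Falsifies f (Function.update σ y a) S := by
  refine ⟨h.1, fun w hw => ?_⟩
  obtain ⟨h₁, h₂, h₃⟩ := h.2 w hw
  have key : ∀ φ : QForm 0, ¬ φ.Occurs y → (M.Force (Function.update σ y a) φ Fin.elim0 (f w) ↔
      M.Force σ φ Fin.elim0 (f w)) := fun φ hφ =>
    force_congr φ (fun z hz => Function.update_of_ne (fun e : z = y => hφ (e ▸ hz)) _ _) _ _
  refine ⟨fun x hx => ?_, fun φ hφ => ?_, fun φ hφ => ?_⟩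
  · rw [Function.update_of_ne (fun e : x = y => (hy w hw).1 (e ▸ hx))]
    exact h₁ x hx
  · exact (key φ ((hy w hw).2 φ (.inl hφ))).2 (h₂ φ hφ)
  · exact fun hf => h₃ φ hφ ((key φ ((hy w hw).2 φ (.inr hφ))).1 hf)

theorem Falsifies.mem_dom {f : ℕ → M.World} {σ : ℕ → M.U} {S : QSeq}
    (h : M.Falsifies f σ S) {y w : ℕ} (hy : S.Available y w) : σ y ∈ M.dom (f w) := by
  obtain ⟨u, huw, hyu⟩ := hy
  exact M.dom_mono (h.rel_of_reach huw) ((h.2 u huw.1).1 y hyu)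

/-- Instantiating a quantifier by a variable that does not occur in its scope, after giving that
variable the value `a`, is evaluating the scope at `a`. -/
theorem force_inst_update {σ : ℕ → M.U} {φ : QForm 1} {y : ℕ} (hy : ¬ φ.Occurs y) {a : M.U}
    {ρ : Fin 0 → M.U} {w : M.World} : M.Force (Function.update σ y a) (φ.inst y) ρ w ↔
      M.Force σ φ (Fin.snoc (α := fun _ : Fin 1 => M.U) ρ a) w := by
  rw [force_inst_iff_snoc, Function.update_self]
  exact force_congr φ (fun z hz => Function.update_of_ne (fun e : z = y => hy (e ▸ hz)) _ _) _ _

@[simp] theorem refutes_inp {σ : ℕ → M.U} {v : M.World} {φ : QForm 0} :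
    M.Refutes σ v (0, {Pol.inp φ}) ↔ M.Force σ φ Fin.elim0 v := by
  simp [Refutes]

@[simp] theorem refutes_out {σ : ℕ → M.U} {v : M.World} {φ : QForm 0} :
    M.Refutes σ v (0, {Pol.out φ}) ↔ ¬ M.Force σ φ Fin.elim0 v := by
  simp [Refutes]

/-- Soundness of the rules, in contrapositive form: if the conclusion of a rule instance is
falsified, so is one of its premises. -/
theorem exists_falsifies_premise {L : Dom} (hM : L = .CD → ∀ w, M.dom w = Set.univ)
    {Ps : List QSeq} {C : QSeq} (hR : RuleSet.extend (NQ L) CutQ Ps C) {f : ℕ → M.World}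
    {σ : ℕ → M.U} (hC : M.Falsifies f σ C) :
    ∃ P ∈ Ps, ∃ f' σ', M.Falsifies f' σ' P := by
  classical
  rcases hR with hR | hR
  · cases hR with
    | id S hwu p x =>
      rw [falsifies_put (by exact hwu.2.1), falsifies_put hwu.1] at hC
      obtain ⟨⟨hS, h₁⟩, h₂⟩ := hC
      simp only [refutes_inp, refutes_out, QForm.pred, Force] at h₁ h₂
      exact absurd (M.val_mono (hS.rel_of_reach hwu) h₁) h₂
    | botIn S hw =>
      rw [falsifies_put hw] at hC
      simp [Force] at hC
    | ds S hw p x =>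
      rw [falsifies_put hw] at hC
      refine ⟨_, List.mem_singleton_self _, f, σ, (falsifies_put hw).2 ⟨hC.1, ?_⟩⟩
      have h := hC.2
      rw [refutes_inp] at h
      refine ⟨?_, (refutes_inp.2 h).2⟩
      intro z hz
      obtain ⟨i, rfl⟩ : ∃ i, x i = z := by simpa [List.mem_ofFn] using hz
      exact M.val_dom h i
    | orIn S hw φ ψ =>
      rw [falsifies_put hw, refutes_inp] at hC
      rcases hC.2 with h | h
      · exact ⟨_, by simp, f, σ, (falsifies_put hw).2 ⟨hC.1, refutes_inp.2 h⟩⟩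
      · exact ⟨S.put _ (0, {.inp ψ}), by simp, f, σ,
          (falsifies_put hw).2 ⟨hC.1, refutes_inp.2 h⟩⟩
    | orOut S hw φ ψ =>
      rw [falsifies_put hw, refutes_out] at hC
      refine ⟨_, List.mem_singleton_self _, f, σ, (falsifies_put hw).2 ⟨hC.1, ?_⟩⟩
      have h := hC.2
      simp only [Force, not_or] at h
      simpa [Refutes] using h
    | andIn S hw φ ψ =>
      rw [falsifies_put hw, refutes_inp] at hC
      refine ⟨_, List.mem_singleton_self _, f, σ, (falsifies_put hw).2 ⟨hC.1, ?_⟩⟩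
      have h := hC.2
      simp only [Force] at h
      simpa [Refutes] using h
    | andOut S hw φ ψ =>
      rw [falsifies_put hw, refutes_out] at hC
      have h := hC.2
      simp only [Force, not_and_or] at h
      rcases h with h | h
      · exact ⟨_, by simp, f, σ, (falsifies_put hw).2 ⟨hC.1, refutes_out.2 h⟩⟩
      · exact ⟨S.put _ (0, {.out ψ}), by simp, f, σ,
          (falsifies_put hw).2 ⟨hC.1, refutes_out.2 h⟩⟩
    | @impIn S w u hwu φ ψ =>
      have h := (falsifies_put hwu.1).1 hC
      rw [refutes_inp] at h
      by_cases hφ : M.Force σ φ Fin.elim0 (f u)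
      · exact ⟨(S.put w (0, {.inp (.imp φ ψ)})).put u (0, {.inp ψ}), by simp, f, σ,
          (falsifies_put (by exact hwu.2.1)).2
            ⟨hC, refutes_inp.2 (h.2 _ (h.1.rel_of_reach hwu) hφ)⟩⟩
      · exact ⟨_, by simp, f, σ, (falsifies_put (by exact hwu.2.1)).2 ⟨hC, refutes_out.2 hφ⟩⟩
    | impOut S hw hu φ ψ =>
      rw [falsifies_put hw, refutes_out] at hC
      have h := hC.2
      simp only [Force, not_forall] at h
      obtain ⟨v, hv, hφ, hψ⟩ := h
      exact ⟨_, List.mem_singleton_self _, _, σ,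
        hC.1.nest hw hu hv (by simpa [Refutes] using ⟨hφ, hψ⟩)⟩
    | @exIn S w hw φ y hy =>
      have h := (falsifies_put hw).1 hC
      rw [refutes_inp] at h
      obtain ⟨a, ha, hφ⟩ := h.2
      have hocc : ¬ φ.Occurs y := (hy w hw).2 (.ex φ) (.inl (by simp))
      refine ⟨_, List.mem_singleton_self _, f, Function.update σ y a,
        (falsifies_put hw).2 ⟨((falsifies_put hw).1 (hC.update hy a)).1, ?_⟩⟩
      simpa [Refutes, force_inst_update hocc] using ⟨ha, hφ⟩
    | @exOut₁ S w hw φ y hy =>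
      rw [falsifies_put hw, refutes_out] at hC
      refine ⟨_, List.mem_singleton_self _, f, σ, (falsifies_put hw).2 ⟨hC.1, ?_⟩⟩
      have ha : σ y ∈ M.dom (f w) := by
        cases L with
        | ND => exact hC.1.mem_dom (hy rfl)
        | CD => simp [hM rfl]
      have h : ¬ M.Force σ (φ.inst y) Fin.elim0 (f w) := fun h =>
        hC.2 ⟨σ y, ha, force_inst_iff_snoc.1 h⟩
      simpa [Refutes] using ⟨h, hC.2⟩
    | @exOut₂ S w u hw hu φ y hwu hy =>
      have h := (falsifies_put hu).1 hC
      rw [refutes_out] at h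
      obtain ⟨a, ha⟩ := M.dom_nonempty (f w)
      have hau : a ∈ M.dom (f u) := by
        cases L with
        | ND => exact M.dom_mono (h.1.rel_of_reach (hwu rfl)) ha
        | CD => simp [hM rfl]
      have hocc : ¬ φ.Occurs y := (hy u hu).2 (.ex φ) (.inr (by simp))
      have h' := (falsifies_put hu).1 (hC.update hy a)
      rw [refutes_out] at h'
      refine ⟨_, List.mem_singleton_self _, f, Function.update σ y a,
        (falsifies_put (by exact hu)).2 ⟨(falsifies_put hw).2 ⟨h'.1, ?_⟩, ?_⟩⟩
      · simpa [Refutes] using ha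
      · have : ¬ M.Force (Function.update σ y a) (φ.inst y) Fin.elim0 (f u) := fun hf =>
          h.2 ⟨a, hau, (force_inst_update hocc).1 hf⟩
        simpa [Refutes] using ⟨this, h'.2⟩
    | @allIn₁ S w u hwu φ y hy =>
      have h := (falsifies_put hwu.1).1 hC
      rw [refutes_inp] at h
      have ha : σ y ∈ M.dom (f u) := by
        cases L with
        | ND => exact h.1.mem_dom (hy rfl)
        | CD => simp [hM rfl]
      exact ⟨_, List.mem_singleton_self _, f, σ, (falsifies_put (by exact hwu.2.1)).2
        ⟨hC, refutes_inp.2 (force_inst_iff_snoc.2 (h.2 _ (h.1.rel_of_reach hwu) _ ha))⟩⟩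
    | @allIn₂ S w u v hw huv φ y hwu hy =>
      have h := (falsifies_put huv.1).1 hC
      rw [refutes_inp] at h
      obtain ⟨a, ha⟩ := M.dom_nonempty (f w)
      have hav : a ∈ M.dom (f v) := by
        cases L with
        | ND => exact M.dom_mono (h.1.rel_of_reach ((hwu rfl).trans huv)) ha
        | CD => simp [hM rfl]
      have hocc : ¬ φ.Occurs y := (hy u huv.1).2 (.all φ) (.inl (by simp))
      have h' := (falsifies_put huv.1).1 (hC.update hy a)
      refine ⟨_, List.mem_singleton_self _, f, Function.update σ y a,
        (falsifies_put (by exact huv.2.1)).2 ⟨(falsifies_put (by exact huv.1)).2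
          ⟨(falsifies_put hw).2 ⟨h'.1, ?_⟩, h'.2⟩, ?_⟩⟩
      · simpa [Refutes] using ha
      · exact refutes_inp.2 ((force_inst_update hocc).2
          (h.2 _ (h.1.rel_of_reach huv) a hav))
    | @allOut S w u hw hu φ y hy =>
      have h := (falsifies_put hw).1 hC
      rw [refutes_out] at h
      have h₂ := h.2
      simp only [Force, not_forall] at h₂
      obtain ⟨v, hv, a, ha, hφ⟩ := h₂
      have hocc : ¬ φ.Occurs y := (hy w hw).2 (.all φ) (.inr (by simp))
      have h' := (falsifies_put hw).1 (hC.update hy a)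
      refine ⟨_, List.mem_singleton_self _, _, Function.update σ y a, h'.1.nest hw hu hv ?_⟩
      simpa [Refutes, force_inst_update hocc] using ⟨ha, hφ⟩
  · cases hR with
    | @cut S w hw φ =>
      by_cases hφ : M.Force σ φ Fin.elim0 (f w)
      · exact ⟨C.put w (0, {.inp φ}), by simp, f, σ,
          (falsifies_put hw).2 ⟨hC, refutes_inp.2 hφ⟩⟩
      · exact ⟨_, by simp, f, σ, (falsifies_put hw).2 ⟨hC, refutes_out.2 hφ⟩⟩

theorem not_falsifies_of_derivable {L : Dom} (hM : L = .CD → ∀ w, M.dom w = Set.univ)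
    {C : QSeq} (h : Derivable (RuleSet.extend (NQ L) CutQ) C) :
    ∀ (f : ℕ → M.World) (σ : ℕ → M.U), ¬ M.Falsifies f σ C := by
  induction h with
  | step rule _ ih =>
    intro f σ hC
    obtain ⟨P, hP, f', σ', hF⟩ := exists_falsifies_premise hM rule hC
    exact ih P hP f' σ' hF

end KModel

/-! ### Backward application of the rules -/

/-- A fair infinite run: if from every state with property `P` each of countably many tasks can
be carried out without leaving `P`, there is an infinite run in which each task is carried out
infinitely often. -/
theorem exists_fair_run {α ι : Type} [Countable ι] [Nonempty ι] {P : α → Prop}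
    {r : ι → α → α → Prop} (h : ∀ i s, P s → ∃ t, P t ∧ r i s t) {s₀ : α} (h₀ : P s₀) :
    ∃ (f : ℕ → α) (t : ℕ → ι), f 0 = s₀ ∧ (∀ n, P (f n)) ∧ (∀ n, r (t n) (f n) (f (n + 1))) ∧
      ∀ i N, ∃ n ≥ N, t n = i := by
  choose g hgP hgr using h
  obtain ⟨e, he⟩ := exists_surjective_nat ι
  let run : ℕ → {s // P s} := fun n =>
    Nat.rec ⟨s₀, h₀⟩ (fun n s => ⟨g (e n.unpair.1) s.1 s.2, hgP _ _ _⟩) n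
  refine ⟨fun n => (run n).1, fun n => e n.unpair.1, rfl, fun n => (run n).2,
    fun n => hgr _ _ _, fun i N => ?_⟩
  obtain ⟨k, hk⟩ := he i
  exact ⟨Nat.pair k N, Nat.right_le_pair k N, by simp [hk]⟩

theorem exists_underivable_premise {S : Type} {R : RuleSet S} {Ps : List S} {C : S}
    (hC : ¬ Derivable R C) (h : R Ps C) : ∃ P ∈ Ps, ¬ Derivable R P := by
  by_contra! hP
  exact hC (.step h hP)

namespace Pol

/-- The formulae that the rules keep in the premises; all other principal formulae are replaced
by their immediate subformulae. -/
def Persistent : Pol (QForm 0) → Prop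
  | .inp (.atom _ _) => True
  | .inp (.imp _ _) => True
  | .inp (.all _) => True
  | .out (.atom _ _) => True
  | .out (.ex _) => True
  | _ => False

instance {F : Type} [Countable F] : Countable (Pol F) := by
  have : Function.Injective fun A : Pol F =>
      (match A with | .inp φ => Sum.inl φ | .out φ => Sum.inr φ : F ⊕ F) := by
    rintro (φ | φ) (ψ | ψ) h <;> simp_all
  exact this.countable

end Pol

/-- What the backward application of a rule with principal formula `A` at the label `w` of `S`
achieves in the resulting sequent `T`. The label `u` and the variable `y` are the parameters of
the rules that can be applied to the same formula more than once. -/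
def Reduced (L : Dom) (S T : QSeq) (w u y : ℕ) : Pol (QForm 0) → Prop
  | .inp (.atom _ x) => ∀ i z, x i = Sum.inl z → z ∈ (T.comp w).1
  | .inp .bot => True
  | .inp (.or φ ψ) => .inp φ ∈ (T.comp w).2 ∨ .inp ψ ∈ (T.comp w).2
  | .inp (.and φ ψ) => .inp φ ∈ (T.comp w).2 ∧ .inp ψ ∈ (T.comp w).2
  | .inp (.imp φ ψ) => S.Reach w u → .out φ ∈ (T.comp u).2 ∨ .inp ψ ∈ (T.comp u).2
  | .inp (.ex φ) => ∃ z ∈ (T.comp w).1, .inp (φ.inst z) ∈ (T.comp w).2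
  | .inp (.all φ) => (∃ z, z ∈ (T.comp 0).1) ∧
      (S.Reach w u → (L = .ND → S.Available y u) → .inp (φ.inst y) ∈ (T.comp u).2)
  | .out (.atom _ _) => True
  | .out .bot => True
  | .out (.or φ ψ) => .out φ ∈ (T.comp w).2 ∧ .out ψ ∈ (T.comp w).2
  | .out (.and φ ψ) => .out φ ∈ (T.comp w).2 ∨ .out ψ ∈ (T.comp w).2
  | .out (.imp φ ψ) => ∃ v, (w, v) ∈ T.edges ∧ .inp φ ∈ (T.comp v).2 ∧ .out ψ ∈ (T.comp v).2
  | .out (.ex φ) => (∃ z, z ∈ (T.comp 0).1) ∧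
      ((L = .ND → S.Available y w) → .out (φ.inst y) ∈ (T.comp w).2)
  | .out (.all φ) => ∃ v, (w, v) ∈ T.edges ∧
      ∃ z ∈ (T.comp v).1, .out (φ.inst z) ∈ (T.comp v).2

/-- The sequent `T` contains everything that occurs in `S`, except, possibly, for the formula `A`
at the label `w` if it is not persistent. Only membership matters, multiplicities do not. -/
structure Extends (w : ℕ) (A : Pol (QForm 0)) (S T : QSeq) : Prop where
  labels : S.labels ⊆ T.labels
  edges : S.edges ⊆ T.edges
  sig : ∀ v ∈ S.labels, ∀ x ∈ (S.comp v).1, x ∈ (T.comp v).1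
  keep : ∀ v ∈ S.labels, ∀ B ∈ (S.comp v).2,
    B ∈ (T.comp v).2 ∨ (v = w ∧ B = A ∧ ¬ B.Persistent)

namespace Extends

theorem refl (w : ℕ) (A : Pol (QForm 0)) (S : QSeq) : Extends w A S S :=
  ⟨subset_rfl, subset_rfl, fun _ _ _ h => h, fun _ _ _ h => .inl h⟩

theorem trans {w : ℕ} {A : Pol (QForm 0)} {S T U : QSeq} (h : Extends w A S T)
    (h' : Extends w A T U) : Extends w A S U where
  labels := h.labels.trans h'.labels
  edges := h.edges.trans h'.edges
  sig v hv x hx := h'.sig v (h.labels hv) x (h.sig v hv x hx)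
  keep v hv B hB := (h.keep v hv B hB).elim (h'.keep v (h.labels hv) B) .inr

theorem put {w v : ℕ} {A : Pol (QForm 0)} {S : QSeq}
    {d : Multiset ℕ × Multiset (Pol (QForm 0))} : Extends w A S (S.put v d) :=
  ⟨subset_rfl, subset_rfl, fun _ _ _ h => QSeq.mem_sig_put.2 (.inl h),
    fun _ _ _ h => .inl (QSeq.mem_form_put.2 (.inl h))⟩

theorem replace {w : ℕ} {A : Pol (QForm 0)} {T : QSeq} (hA : ¬ A.Persistent)
    {d : Multiset ℕ × Multiset (Pol (QForm 0))} :
    Extends w A (T.put w (0, {A})) (T.put w d) where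
  labels := subset_rfl
  edges := subset_rfl
  sig v _ x h := by
    rw [QSeq.mem_sig_put] at h ⊢
    simpa using Or.inl (b := v = w ∧ x ∈ d.1) (by simpa using h)
  keep v _ B h := by
    rw [QSeq.mem_form_put] at h ⊢
    rcases h with h | ⟨rfl, h⟩
    · exact .inl (.inl h)
    · obtain rfl := Multiset.mem_singleton.1 h
      exact .inr ⟨rfl, rfl, hA⟩

theorem nest {w u : ℕ} {A : Pol (QForm 0)} {T : QSeq} (hA : ¬ A.Persistent)
    (hw : w ∈ T.labels) (hu : u ∉ T.labels) {d : Multiset ℕ × Multiset (Pol (QForm 0))} :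
    Extends w A (T.put w (0, {A})) (T.nest w u hw hu d) where
  labels := Finset.subset_insert _ _
  edges := Finset.subset_insert _ _
  sig v hv x h := by
    have hne : v ≠ u := fun e => hu (e ▸ hv)
    rw [QSeq.mem_sig_put] at h
    simpa [NSeq.nest, hne] using h
  keep v hv B h := by
    have hne : v ≠ u := fun e => hu (e ▸ hv)
    rw [QSeq.mem_form_put] at h
    rcases h with h | ⟨rfl, h⟩
    · exact .inl (by simpa [NSeq.nest, hne] using h)
    · obtain rfl := Multiset.mem_singleton.1 h
      exact .inr ⟨rfl, rfl, hA⟩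

theorem reach {w : ℕ} {A : Pol (QForm 0)} {S T : QSeq} (h : Extends w A S T) {a b : ℕ}
    (hab : S.Reach a b) : T.Reach a b :=
  ⟨h.labels hab.1, h.labels hab.2.1,
    Relation.ReflTransGen.mono (fun _ _ e => h.edges e) _ _ hab.2.2⟩

theorem available {w : ℕ} {A : Pol (QForm 0)} {S T : QSeq} (h : Extends w A S T) {y a : ℕ}
    (hy : S.Available y a) : T.Available y a := by
  obtain ⟨u, hu, hyu⟩ := hy
  exact ⟨u, h.reach hu, h.sig u hu.1 y hyu⟩

theorem nonempty_root {w : ℕ} {A : Pol (QForm 0)} {S T : QSeq} (h : Extends w A S T)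
    (hS : ∃ z, z ∈ (S.comp 0).1) : ∃ z, z ∈ (T.comp 0).1 :=
  hS.imp (h.sig 0 S.root_mem)

end Extends

theorem QSeq.available_put {S : QSeq} {w y v : ℕ} {Γ : Multiset (Pol (QForm 0))} :
    QSeq.Available (S.put w (0, Γ)) y v ↔ S.Available y v := by
  simp [QSeq.Available, QSeq.mem_sig_put]

/-- If one of the rules for `∃` on the right and `∀` on the left can be applied, then a fresh
variable can be put into the signature of the root. This is what makes the domains of the
countermodel nonempty. -/
theorem exists_nonempty_root {L : Dom} {S : QSeq} (hS : ¬ Derivable (NQ L) S) {w : ℕ}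
    {A : Pol (QForm 0)} (hw : w ∈ S.labels) (hA : A ∈ (S.comp w).2)
    (h : (∃ φ, A = .out (.ex φ)) ∨ ∃ φ, A = .inp (.all φ)) :
    ∃ T, ¬ Derivable (NQ L) T ∧ Extends w A S T ∧ ∃ z, z ∈ (T.comp 0).1 := by
  obtain ⟨T, rfl⟩ := QSeq.exists_eq_put hA
  replace hw : w ∈ T.labels := hw
  obtain ⟨z, hz⟩ := QSeq.exists_fresh (T.put w (0, {A}))
  have hext : ∀ Γ : Multiset (Pol (QForm 0)), A ∈ Γ →
      Extends w A (T.put w (0, {A})) ((T.put 0 ({z}, 0)).put w (0, Γ)) := by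
    refine fun Γ hΓ => ⟨subset_rfl, subset_rfl, fun v _ x h => ?_, fun v _ B h => ?_⟩
    · simp only [QSeq.mem_sig_put] at h ⊢
      exact .inl (.inl (by simpa using h))
    · simp only [QSeq.mem_form_put] at h ⊢
      rcases h with h | ⟨rfl, h⟩
      · exact .inl (.inl (.inl h))
      · obtain rfl := Multiset.mem_singleton.1 h
        exact .inl (.inr ⟨rfl, hΓ⟩)
  rcases h with ⟨φ, rfl⟩ | ⟨φ, rfl⟩
  · obtain ⟨P, hP, hPd⟩ := exists_underivable_premise hS
      (.exOut₂ T T.root_mem hw φ z (fun _ => T.reach_root hw) hz)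
    obtain rfl := List.mem_singleton.1 hP
    exact ⟨_, hPd, hext _ (by simp), z, by simp [QSeq.mem_sig_put]⟩
  · obtain ⟨P, hP, hPd⟩ := exists_underivable_premise hS
      (.allIn₂ T T.root_mem (.refl hw) φ z (fun _ => T.reach_root hw) hz)
    obtain rfl := List.mem_singleton.1 hP
    exact ⟨_, hPd, (hext _ (by simp)).trans .put, z, by simp [QSeq.mem_sig_put]⟩

theorem exists_instance_exOut {L : Dom} {S : QSeq} (hS : ¬ Derivable (NQ L) S) {w y : ℕ}
    {φ : QForm 1} (hw : w ∈ S.labels) (hA : .out (.ex φ) ∈ (S.comp w).2)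
    (hy : L = .ND → S.Available y w) :
    ∃ T, ¬ Derivable (NQ L) T ∧ Extends w (.out (.ex φ)) S T ∧
      .out (φ.inst y) ∈ (T.comp w).2 := by
  obtain ⟨T, rfl⟩ := QSeq.exists_eq_put hA
  obtain ⟨P, hP, hPd⟩ := exists_underivable_premise hS
    (.exOut₁ T hw φ y fun h => QSeq.available_put.1 (hy h))
  obtain rfl := List.mem_singleton.1 hP
  refine ⟨_, hPd, ⟨subset_rfl, subset_rfl, fun v _ x h => ?_, fun v _ B h => ?_⟩, by simp⟩
  · simpa only [QSeq.mem_sig_put] using h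
  · rw [QSeq.mem_form_put] at h ⊢
    exact .inl (h.imp_right fun h => ⟨h.1, by simp_all⟩)

theorem exists_instance_allIn {L : Dom} {S : QSeq} (hS : ¬ Derivable (NQ L) S) {w u y : ℕ}
    {φ : QForm 1} (hwu : S.Reach w u) (hA : .inp (.all φ) ∈ (S.comp w).2)
    (hy : L = .ND → S.Available y u) :
    ∃ T, ¬ Derivable (NQ L) T ∧ Extends w (.inp (.all φ)) S T ∧
      .inp (φ.inst y) ∈ (T.comp u).2 := by
  obtain ⟨T, rfl⟩ := QSeq.exists_eq_put hA
  obtain ⟨P, hP, hPd⟩ := exists_underivable_premise hS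
    (.allIn₁ T hwu φ y fun h => QSeq.available_put.1 (hy h))
  obtain rfl := List.mem_singleton.1 hP
  exact ⟨_, hPd, .put, by simp⟩

/-- Every rule can be applied backwards to an underivable sequent so that the result is again
underivable. -/
theorem exists_reduced {L : Dom} {S : QSeq} (hS : ¬ Derivable (NQ L) S) {w : ℕ}
    {A : Pol (QForm 0)} (hw : w ∈ S.labels) (hA : A ∈ (S.comp w).2) (u y : ℕ) :
    ∃ T, ¬ Derivable (NQ L) T ∧ Extends w A S T ∧ Reduced L S T w u y A := by
  obtain ⟨T, rfl⟩ := QSeq.exists_eq_put hA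
  replace hw : w ∈ T.labels := hw
  obtain ⟨v, hv⟩ := Infinite.exists_notMem_finset T.labels
  obtain ⟨z, hz⟩ := QSeq.exists_fresh (T.put w (0, {A}))
  match A with
  | .inp (.atom p x) =>
    obtain ⟨a, ha⟩ := QForm.exists_eq_pred p x
    rw [ha] at hS ⊢
    obtain ⟨P, hP, hPd⟩ := exists_underivable_premise hS (.ds T hw p a)
    obtain rfl := List.mem_singleton.1 hP
    refine ⟨_, hPd, ⟨subset_rfl, subset_rfl, ?_, ?_⟩, ?_⟩
    · intro v _ x h
      rw [QSeq.mem_sig_put] at h ⊢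
      exact .inl (by simpa using h)
    · intro v _ B h
      rw [QSeq.mem_form_put] at h ⊢
      exact .inl h
    · rintro i z hz
      obtain rfl : a i = z := by simpa using hz
      exact QSeq.mem_sig_put.2 (.inr ⟨rfl, by simp [List.mem_ofFn]⟩)
  | .inp .bot => exact ⟨_, hS, .refl _ _ _, trivial⟩
  | .out (.atom _ _) => exact ⟨_, hS, .refl _ _ _, trivial⟩
  | .out .bot => exact ⟨_, hS, .refl _ _ _, trivial⟩
  | .inp (.or φ ψ) =>
    obtain ⟨P, hP, hPd⟩ := exists_underivable_premise hS (.orIn T hw φ ψ)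
    simp only [List.mem_cons, List.not_mem_nil, or_false] at hP
    rcases hP with rfl | rfl <;>
      exact ⟨_, hPd, .replace (by simp [Pol.Persistent]), by simp [Reduced]⟩
  | .inp (.and φ ψ) =>
    obtain ⟨P, hP, hPd⟩ := exists_underivable_premise hS (.andIn T hw φ ψ)
    obtain rfl := List.mem_singleton.1 hP
    exact ⟨_, hPd, .replace (by simp [Pol.Persistent]), by simp [Reduced]⟩
  | .out (.or φ ψ) =>
    obtain ⟨P, hP, hPd⟩ := exists_underivable_premise hS (.orOut T hw φ ψ)
    obtain rfl := List.mem_singleton.1 hP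
    exact ⟨_, hPd, .replace (by simp [Pol.Persistent]), by simp [Reduced]⟩
  | .out (.and φ ψ) =>
    obtain ⟨P, hP, hPd⟩ := exists_underivable_premise hS (.andOut T hw φ ψ)
    simp only [List.mem_cons, List.not_mem_nil, or_false] at hP
    rcases hP with rfl | rfl <;>
      exact ⟨_, hPd, .replace (by simp [Pol.Persistent]), by simp [Reduced]⟩
  | .inp (.imp φ ψ) =>
    by_cases hwu : T.Reach w u
    · obtain ⟨P, hP, hPd⟩ := exists_underivable_premise hS (.impIn T hwu φ ψ)
      simp only [List.mem_cons, List.not_mem_nil, or_false] at hP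
      rcases hP with rfl | rfl <;>
        exact ⟨_, hPd, .put, by simp [Reduced, QSeq.mem_form_put]⟩
    · exact ⟨_, hS, .refl _ _ _, fun h => absurd h hwu⟩
  | .out (.imp φ ψ) =>
    obtain ⟨P, hP, hPd⟩ := exists_underivable_premise hS (.impOut T hw hv φ ψ)
    obtain rfl := List.mem_singleton.1 hP
    exact ⟨_, hPd, .nest (by simp [Pol.Persistent]) hw hv, v, by simp [NSeq.nest]⟩
  | .inp (.ex φ) =>
    obtain ⟨P, hP, hPd⟩ := exists_underivable_premise hS (.exIn T hw φ z hz)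
    obtain rfl := List.mem_singleton.1 hP
    exact ⟨_, hPd, .replace (by simp [Pol.Persistent]), z, by simp⟩
  | .out (.all φ) =>
    obtain ⟨P, hP, hPd⟩ := exists_underivable_premise hS (.allOut T hw hv φ z hz)
    obtain rfl := List.mem_singleton.1 hP
    exact ⟨_, hPd, .nest (by simp [Pol.Persistent]) hw hv, v, by simp [NSeq.nest]⟩
  | .out (.ex φ) =>
    obtain ⟨U, hU, hext, hroot⟩ := exists_nonempty_root hS hw hA (.inl ⟨φ, rfl⟩)
    by_cases hy : L = .ND → QSeq.Available (T.put w (0, {.out (.ex φ)})) y w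
    · have hA' := (hext.keep w hw _ hA).resolve_right fun h => h.2.2 trivial
      obtain ⟨V, hV, hext', h⟩ := exists_instance_exOut hU (hext.labels hw) hA'
        fun h => hext.available (hy h)
      exact ⟨V, hV, hext.trans hext', hext'.nonempty_root hroot, fun _ => h⟩
    · exact ⟨U, hU, hext, hroot, fun h => absurd h hy⟩
  | .inp (.all φ) =>
    obtain ⟨U, hU, hext, hroot⟩ := exists_nonempty_root hS hw hA (.inr ⟨φ, rfl⟩)
    by_cases hy : T.Reach w u ∧ (L = .ND → QSeq.Available (T.put w (0, {.inp (.all φ)})) y u)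
    · have hA' := (hext.keep w hw _ hA).resolve_right fun h => h.2.2 trivial
      obtain ⟨V, hV, hext', h⟩ := exists_instance_allIn hU (hext.reach hy.1) hA'
        fun h => hext.available (hy.2 h)
      exact ⟨V, hV, hext.trans hext', hext'.nonempty_root hroot, fun _ _ => h⟩
    · exact ⟨U, hU, hext, hroot, fun h h' => absurd ⟨h, h'⟩ hy⟩

/-! ### Fair runs and the countermodel -/

/-- An infinite run of a fair backward proof search that never meets a derivable sequent. Each
stage results from the one before by treating the formula `form n` at the label `label n`, if it
is present there, with the label `succ n` and the variable `var n` as parameters. Every combination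
of these four comes up infinitely often. -/
structure FairRun (L : Dom) where
  seq : ℕ → QSeq
  label : ℕ → ℕ
  form : ℕ → Pol (QForm 0)
  succ : ℕ → ℕ
  var : ℕ → ℕ
  underivable : ∀ n, ¬ Derivable (NQ L) (seq n)
  step : ∀ n, Extends (label n) (form n) (seq n) (seq (n + 1))
  reduced : ∀ n, label n ∈ (seq n).labels → form n ∈ ((seq n).comp (label n)).2 →
    Reduced L (seq n) (seq (n + 1)) (label n) (succ n) (var n) (form n)
  fair : ∀ w A u y N, ∃ n ≥ N, label n = w ∧ form n = A ∧ succ n = u ∧ var n = y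

theorem exists_fairRun {L : Dom} {S : QSeq} (hS : ¬ Derivable (NQ L) S) :
    ∃ F : FairRun L, F.seq 0 = S := by
  have key : ∀ (i : ℕ × Pol (QForm 0) × ℕ × ℕ) (S : QSeq), ¬ Derivable (NQ L) S →
      ∃ T, ¬ Derivable (NQ L) T ∧ Extends i.1 i.2.1 S T ∧
        (i.1 ∈ S.labels → i.2.1 ∈ (S.comp i.1).2 →
          Reduced L S T i.1 i.2.2.1 i.2.2.2 i.2.1) := by
    rintro ⟨w, A, u, y⟩ S hS
    by_cases h : w ∈ S.labels ∧ A ∈ (S.comp w).2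
    · obtain ⟨T, h₁, h₂, h₃⟩ := exists_reduced hS h.1 h.2 u y
      exact ⟨T, h₁, h₂, fun _ _ => h₃⟩
    · exact ⟨S, hS, .refl _ _ _, fun h₁ h₂ => absurd ⟨h₁, h₂⟩ h⟩
  have : Nonempty (ℕ × Pol (QForm 0) × ℕ × ℕ) := ⟨(0, .inp .bot, 0, 0)⟩
  obtain ⟨f, t, h0, hP, hr, hfair⟩ := exists_fair_run key hS
  refine ⟨⟨f, fun n => (t n).1, fun n => (t n).2.1, fun n => (t n).2.2.1,
    fun n => (t n).2.2.2, hP, fun n => (hr n).1, fun n => (hr n).2, fun w A u y N => ?_⟩, h0⟩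
  obtain ⟨n, hn, hi⟩ := hfair (w, A, u, y) N
  exact ⟨n, hn, by simp [hi]⟩

namespace FairRun

variable {L : Dom} (F : FairRun L)

/-- The polarized formula `A` occurs at the label `w` at the stage `n`. -/
def Occ (n w : ℕ) (A : Pol (QForm 0)) : Prop :=
  w ∈ (F.seq n).labels ∧ A ∈ ((F.seq n).comp w).2

variable {F}

theorem mem_labels {m n w : ℕ} (hmn : m ≤ n) (h : w ∈ (F.seq m).labels) :
    w ∈ (F.seq n).labels :=
  monotone_nat_of_le_succ (f := fun n => (F.seq n).labels) (fun n => (F.step n).labels) hmn h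

theorem mem_edges {m n : ℕ} (hmn : m ≤ n) {e : ℕ × ℕ} (h : e ∈ (F.seq m).edges) :
    e ∈ (F.seq n).edges :=
  monotone_nat_of_le_succ (f := fun n => (F.seq n).edges) (fun n => (F.step n).edges) hmn h

theorem mem_sig {m n w x : ℕ} (hmn : m ≤ n) (hw : w ∈ (F.seq m).labels)
    (h : x ∈ ((F.seq m).comp w).1) : x ∈ ((F.seq n).comp w).1 := by
  induction n, hmn using Nat.le_induction with
  | base => exact h
  | succ n hn ih => exact (F.step n).sig w (mem_labels hn hw) x ih

theorem reach_mono {m n a b : ℕ} (hmn : m ≤ n) (h : (F.seq m).Reach a b) :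
    (F.seq n).Reach a b := by
  induction n, hmn using Nat.le_induction with
  | base => exact h
  | succ n _ ih => exact (F.step n).reach ih

theorem available_mono {m n y w : ℕ} (hmn : m ≤ n) (h : (F.seq m).Available y w) :
    (F.seq n).Available y w := by
  induction n, hmn using Nat.le_induction with
  | base => exact h
  | succ n _ ih => exact (F.step n).available ih

theorem Occ.mono {m n w : ℕ} {A : Pol (QForm 0)} (h : F.Occ m w A) (hA : A.Persistent)
    (hmn : m ≤ n) : F.Occ n w A := by
  induction n, hmn using Nat.le_induction with
  | base => exact h
  | succ n _ ih =>
    exact ⟨(F.step n).labels ih.1,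
      ((F.step n).keep w ih.1 A ih.2).resolve_right fun h' => h'.2.2 hA⟩

/-- Every formula occurrence is eventually treated. -/
theorem Occ.exists_reduced {n w : ℕ} {A : Pol (QForm 0)} (h : F.Occ n w A) :
    ∃ m ≥ n, w ∈ (F.seq m).labels ∧
      ∃ u y, Reduced L (F.seq m) (F.seq (m + 1)) w u y A := by
  classical
  have hex : ∃ m, n ≤ m ∧ F.label m = w ∧ F.form m = A := by
    obtain ⟨m, hm, h₁, h₂, -⟩ := F.fair w A 0 0 n
    exact ⟨m, hm, h₁, h₂⟩
  -- The formula occurrence is still there at the first stage that treats it.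
  have hocc : ∀ m, n ≤ m → m ≤ Nat.find hex → F.Occ m w A := by
    intro m hm
    induction m, hm using Nat.le_induction with
    | base => exact fun _ => h
    | succ m hm ih =>
      intro hlt
      obtain ⟨h₁, h₂⟩ := ih (Nat.le_of_succ_le hlt)
      refine ⟨(F.step m).labels h₁, ((F.step m).keep w h₁ A h₂).resolve_right fun h' => ?_⟩
      exact Nat.find_min hex hlt ⟨hm, h'.1.symm, h'.2.1.symm⟩
  obtain ⟨hm, hw, hA⟩ := Nat.find_spec hex
  obtain ⟨h₁, h₂⟩ := hocc _ hm le_rfl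
  refine ⟨_, hm, h₁, F.succ (Nat.find hex), F.var (Nat.find hex), ?_⟩
  have := F.reduced (Nat.find hex) (by rwa [hw]) (by rwa [hw, hA])
  rwa [hw, hA] at this

/-- Every persistent formula occurrence is treated, arbitrarily late, with all parameters. -/
theorem Occ.exists_reduced_of_persistent {n w : ℕ} {A : Pol (QForm 0)} (h : F.Occ n w A)
    (hA : A.Persistent) (u y N : ℕ) :
    ∃ m ≥ N, Reduced L (F.seq m) (F.seq (m + 1)) w u y A := by
  obtain ⟨m, hm, rfl, rfl, rfl, rfl⟩ := F.fair w A u y (max n N)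
  have h' := h.mono hA (le_trans (le_max_left _ _) hm)
  exact ⟨m, le_trans (le_max_right _ _) hm, F.reduced m h'.1 h'.2⟩

variable (F) in
/-- Reachability in the union of the trees of all stages. -/
def Rel : ℕ → ℕ → Prop :=
  Relation.ReflTransGen fun a b => ∃ n, (a, b) ∈ (F.seq n).edges

theorem exists_reach {n w v : ℕ} (hw : w ∈ (F.seq n).labels) (h : F.Rel w v) :
    ∃ m ≥ n, (F.seq m).Reach w v := by
  induction h with
  | refl => exact ⟨n, le_rfl, .refl hw⟩
  | tail _ hbc ih =>
    obtain ⟨m, hm, h⟩ := ih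
    obtain ⟨k, hk⟩ := hbc
    have hk' := mem_edges (le_max_right m k) hk
    refine ⟨max m k, hm.trans (le_max_left _ _), (reach_mono (le_max_left _ _) h).trans ?_⟩
    exact ⟨((F.seq _).edge_mem _ _ hk').1, ((F.seq _).edge_mem _ _ hk').2, .single hk'⟩

theorem rel_of_reach {n w v : ℕ} (h : (F.seq n).Reach w v) : F.Rel w v :=
  Relation.ReflTransGen.mono (fun _ _ e => ⟨n, e⟩) _ _ h.2.2

variable (F) in
/-- The domain of a world of the countermodel: the variables that become available for the label,
and everything if the domains are constant or the root signature stays empty. -/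
def domain (w : ℕ) : Set ℕ :=
  {y | L = .ND → (∃ n z, z ∈ ((F.seq n).comp 0).1) →
    ∃ n, y ∈ ((F.seq n).comp 0).1 ∨ (F.seq n).Available y w}

theorem mem_domain_of_available {n y w : ℕ} (h : (F.seq n).Available y w) : y ∈ F.domain w :=
  fun _ _ => ⟨n, .inr h⟩

theorem domain_mono {w v : ℕ} (h : F.Rel w v) : F.domain w ⊆ F.domain v := by
  intro y hy hL hz
  obtain ⟨n, hn | ⟨u, hu, hyu⟩⟩ := hy hL hz
  · exact ⟨n, .inl hn⟩
  · obtain ⟨m, hm, h'⟩ := exists_reach hu.2.1 h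
    exact ⟨m, .inr ⟨u, (reach_mono hm hu).trans h', mem_sig hm hu.1 hyu⟩⟩

theorem exists_available {n w z a : ℕ} (hw : w ∈ (F.seq n).labels)
    (hz : z ∈ ((F.seq n).comp 0).1) (ha : a ∈ F.domain w) :
    ∃ m, L = .ND → (F.seq m).Available a w := by
  cases L with
  | CD => exact ⟨0, fun h => nomatch h⟩
  | ND =>
    obtain ⟨m, hm | hm⟩ := ha rfl ⟨n, z, hz⟩
    · exact ⟨max m n, fun _ => ⟨0, (F.seq _).reach_root (mem_labels (le_max_right _ _) hw),
        mem_sig (le_max_left _ _) (F.seq m).root_mem hm⟩⟩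
    · exact ⟨m, fun _ => hm⟩

variable (F) in
/-- The countermodel read off from a fair run: the worlds are the labels, and an atom holds at the
label `w` if it occurs as an input formula at some label from which `w` is reachable. All natural
numbers are worlds, those that never occur as labels being isolated points. -/
def model : KModel where
  World := ℕ
  rel := F.Rel
  rel_refl _ := .refl
  rel_trans := .trans
  U := ℕ
  dom := F.domain
  dom_nonempty w := by
    by_cases h : ∃ n z, z ∈ ((F.seq n).comp 0).1
    · obtain ⟨n, z, hz⟩ := h
      exact ⟨z, fun _ _ => ⟨n, .inl hz⟩⟩
    · exact ⟨0, fun _ h' => absurd h' h⟩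
  dom_mono := domain_mono
  val w p _ a := ∃ v n, F.Rel v w ∧ F.Occ n v (.inp (.pred p a))
  val_mono := by
    rintro w v h p k a ⟨u, n, hu, ho⟩
    exact ⟨u, n, hu.trans h, ho⟩
  val_dom := by
    rintro w p k a ⟨v, n, hvw, ho⟩ i
    obtain ⟨m, -, hv, u, y, hr⟩ := ho.exists_reduced
    have hv' : v ∈ (F.seq (m + 1)).labels := mem_labels (Nat.le_succ m) hv
    exact domain_mono hvw (mem_domain_of_available ⟨v, .refl hv', hr i (a i) rfl⟩)

/-- An input and an output occurrence of an atom would, both being persistent, meet at a later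
stage and form an instance of the rule `id` there. -/
theorem not_val_of_occ {n w p k : ℕ} {a : Fin k → ℕ} (h : F.Occ n w (.out (.pred p a))) :
    ¬ F.model.val w p a := by
  rintro ⟨v, m, hvw, ho⟩
  obtain ⟨l, hl, hr⟩ := exists_reach (mem_labels (le_max_left m n) ho.1) hvw
  have h₁ := ho.mono (n := l) trivial ((le_max_left m n).trans hl)
  have h₂ := h.mono (n := l) trivial ((le_max_right m n).trans hl)
  obtain ⟨T, hT⟩ := QSeq.exists_eq_put h₂.2
  have h₃ : Pol.inp (.pred p a) ∈ (T.comp v).2 := by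
    have := h₁.2
    rw [hT, QSeq.mem_form_put] at this
    simpa using this
  obtain ⟨T, rfl⟩ := QSeq.exists_eq_put h₃
  refine F.underivable l ?_
  rw [hT] at hr ⊢
  exact .step (.id T hr p a) (by simp)

/-- The truth lemma: in the countermodel, input formulae are forced where they occur and output
formulae are not. -/
theorem truth : ∀ (s : ℕ) (φ : QForm 0), φ.size = s → ∀ n w,
    (F.Occ n w (.inp φ) → F.model.Force id φ Fin.elim0 w) ∧
      (F.Occ n w (.out φ) → ¬ F.model.Force id φ Fin.elim0 w) := by
  intro s
  induction s using Nat.strong_induction_on with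
  | _ s ih =>
  intro φ hs n w
  have hin : ∀ ψ : QForm 0, ψ.size < s → ∀ {n w}, w ∈ (F.seq n).labels →
      .inp ψ ∈ ((F.seq n).comp w).2 → F.model.Force id ψ Fin.elim0 w :=
    fun ψ hψ n w h₁ h₂ => (ih _ hψ ψ rfl n w).1 ⟨h₁, h₂⟩
  have hout : ∀ ψ : QForm 0, ψ.size < s → ∀ {n w}, w ∈ (F.seq n).labels →
      .out ψ ∈ ((F.seq n).comp w).2 → ¬ F.model.Force id ψ Fin.elim0 w :=
    fun ψ hψ n w h₁ h₂ => (ih _ hψ ψ rfl n w).2 ⟨h₁, h₂⟩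
  match φ with
  | .atom p x =>
    obtain ⟨a, ha⟩ := QForm.exists_eq_pred p x
    rw [ha]
    exact ⟨fun h => ⟨w, n, .refl, h⟩, fun h => not_val_of_occ h⟩
  | .bot =>
    refine ⟨fun h => ?_, fun _ h => h⟩
    obtain ⟨T, hT⟩ := QSeq.exists_eq_put h.2
    have hw := h.1
    refine (F.underivable n ?_).elim
    rw [hT] at hw ⊢
    exact .step (.botIn T hw) (by simp)
  | .or φ ψ =>
    have hφ : φ.size < s := by rw [← hs, QForm.size]; omega
    have hψ : ψ.size < s := by rw [← hs, QForm.size]; omega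
    constructor
    · intro h
      obtain ⟨m, -, hw, u, y, hr⟩ := h.exists_reduced
      have hw' := (F.step m).labels hw
      exact hr.imp (hin φ hφ hw') (hin ψ hψ hw')
    · intro h
      obtain ⟨m, -, hw, u, y, hr⟩ := h.exists_reduced
      have hw' := (F.step m).labels hw
      exact fun hf => hf.elim (hout φ hφ hw' hr.1) (hout ψ hψ hw' hr.2)
  | .and φ ψ =>
    have hφ : φ.size < s := by rw [← hs, QForm.size]; omega
    have hψ : ψ.size < s := by rw [← hs, QForm.size]; omega
    constructor
    · intro h
      obtain ⟨m, -, hw, u, y, hr⟩ := h.exists_reduced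
      have hw' := (F.step m).labels hw
      exact hr.imp (hin φ hφ hw') (hin ψ hψ hw')
    · intro h
      obtain ⟨m, -, hw, u, y, hr⟩ := h.exists_reduced
      have hw' := (F.step m).labels hw
      exact fun hf => hr.elim (fun h => hout φ hφ hw' h hf.1) (fun h => hout ψ hψ hw' h hf.2)
  | .imp φ ψ =>
    have hφ : φ.size < s := by rw [← hs, QForm.size]; omega
    have hψ : ψ.size < s := by rw [← hs, QForm.size]; omega
    constructor
    · intro h v hwv hf
      obtain ⟨N, -, hN⟩ := exists_reach h.1 hwv
      obtain ⟨m, hm, hr⟩ := h.exists_reduced_of_persistent trivial v 0 N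
      have hreach := reach_mono hm hN
      have hv := (F.step m).labels hreach.2.1
      exact (hr hreach).elim (fun h' => absurd hf (hout φ hφ hv h')) (hin ψ hψ hv)
    · intro h hf
      obtain ⟨m, -, hw, u, y, v, hwv, h₁, h₂⟩ := h.exists_reduced
      have hv := ((F.seq (m + 1)).edge_mem w v hwv).2
      exact hout ψ hψ hv h₂ (hf v (.single ⟨_, hwv⟩) (hin φ hφ hv h₁))
  | .ex φ =>
    have hφ : ∀ z, (φ.inst z).size < s := fun z => by rw [← hs, QForm.size_inst, QForm.size]; omega
    constructor
    · intro h
      obtain ⟨m, -, hw, u, y, z, hz, hr⟩ := h.exists_reduced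
      have hw' := (F.step m).labels hw
      exact ⟨z, mem_domain_of_available ⟨w, .refl hw', hz⟩,
        KModel.force_inst_iff_snoc.1 (hin _ (hφ z) hw' hr)⟩
    · rintro h ⟨a, ha, hf⟩
      obtain ⟨m, -, hw, u, y, ⟨z, hz⟩, -⟩ := h.exists_reduced
      obtain ⟨N, hN⟩ := exists_available ((F.step m).labels hw) hz ha
      obtain ⟨l, hl, -, hr⟩ := h.exists_reduced_of_persistent trivial 0 a (max n N)
      have hwl := mem_labels (le_trans ((le_max_left _ _).trans hl) (Nat.le_succ l)) h.1
      exact hout _ (hφ a) hwl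
        (hr fun hL => available_mono ((le_max_right _ _).trans hl) (hN hL))
        (KModel.force_inst_iff_snoc.2 hf)
  | .all φ =>
    have hφ : ∀ z, (φ.inst z).size < s := fun z => by rw [← hs, QForm.size_inst, QForm.size]; omega
    constructor
    · intro h v hwv a ha
      obtain ⟨m, -, hw, u, y, ⟨z, hz⟩, -⟩ := h.exists_reduced
      obtain ⟨k, hk, hwv⟩ := exists_reach ((F.step m).labels hw) hwv
      obtain ⟨N, hN⟩ := exists_available hwv.2.1 (mem_sig hk (F.seq _).root_mem hz) ha
      obtain ⟨l, hl, -, hr⟩ := h.exists_reduced_of_persistent trivial v a (max k N)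
      have hreach := reach_mono ((le_max_left _ _).trans hl) hwv
      exact KModel.force_inst_iff_snoc.1 (hin _ (hφ a) ((F.step l).labels hreach.2.1)
        (hr hreach fun hL => available_mono ((le_max_right _ _).trans hl) (hN hL)))
    · intro h hf
      obtain ⟨m, -, hw, u, y, v, hwv, z, hz, hr⟩ := h.exists_reduced
      have hv := ((F.seq (m + 1)).edge_mem w v hwv).2
      exact hout _ (hφ z) hv hr (KModel.force_inst_iff_snoc.2
        (hf v (.single ⟨_, hwv⟩) z (mem_domain_of_available ⟨v, .refl hv, hz⟩)))

theorem falsifies_model : F.model.Falsifies id id (F.seq 0) := by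
  refine ⟨fun a b hab => .single ⟨0, hab⟩, fun w hw => ⟨fun x hx => ?_, fun φ hφ => ?_,
    fun φ hφ => ?_⟩⟩
  · exact mem_domain_of_available ⟨w, .refl hw, hx⟩
  · exact (truth _ φ rfl 0 w).1 ⟨hw, hφ⟩
  · exact (truth _ φ rfl 0 w).2 ⟨hw, hφ⟩

end FairRun

theorem eliminable_cutQ (L : Dom) : Eliminable CutQ (NQ L) := by
  intro C hC
  by_contra hn
  obtain ⟨F, rfl⟩ := exists_fairRun hn
  refine KModel.not_falsifies_of_derivable (M := F.model) (fun hL w => ?_) hC id id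
    F.falsifies_model
  exact Set.eq_univ_of_forall fun y hND => by simp [hL] at hND

/-! ### The propositional calculus as a fragment -/

namespace NSeq

variable {D D' : Type}

/-- Apply `g` to all components of a nested sequent. -/
def map (g : D → D') (S : NSeq D) : NSeq D' :=
  { S with comp := fun w => g (S.comp w) }

theorem map_put [AddCommMonoid D] [AddCommMonoid D'] (g : D →+ D') (S : NSeq D) (w : ℕ) (d : D) :
    (S.put w d).map g = (S.map g).put w (g d) := by
  simp only [map, put, NSeq.mk.injEq, true_and]
  funext v
  by_cases h : v = w
  · subst h; simp
  · simp [h]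

theorem map_nest (g : D → D') (S : NSeq D) (w u : ℕ) (hw : w ∈ S.labels) (hu : u ∉ S.labels)
    (d : D) : (S.nest w u hw hu d).map g = (S.map g).nest w u hw hu (g d) := by
  simp only [map, nest, NSeq.mk.injEq, true_and]
  funext v
  by_cases h : v = u
  · subst h; simp
  · simp [h]

end NSeq

namespace Pol

/-- Apply `g` to the formula, keeping the polarity. -/
def map {F G : Type} (g : F → G) : Pol F → Pol G
  | inp φ => inp (g φ)
  | out φ => out (g φ)

end Pol

/-- The propositional formula as a first-order one, with propositional variables as atoms of
arity `0`. -/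
def PForm.toQForm : PForm → QForm 0
  | atom p => .pred p Fin.elim0
  | bot => .bot
  | or φ ψ => .or φ.toQForm ψ.toQForm
  | and φ ψ => .and φ.toQForm ψ.toQForm
  | imp φ ψ => .imp φ.toQForm ψ.toQForm

namespace QForm

/-- Forget the arguments of the atoms; the value at quantified formulae is irrelevant. -/
def toPForm : {n : ℕ} → QForm n → PForm
  | _, atom p _ => .atom p
  | _, bot => .bot
  | _, or φ ψ => .or (toPForm φ) (toPForm ψ)
  | _, and φ ψ => .and (toPForm φ) (toPForm ψ)
  | _, imp φ ψ => .imp (toPForm φ) (toPForm ψ)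
  | _, ex _ => .bot
  | _, all _ => .bot

/-- The formula contains no quantifiers. -/
def QuantifierFree : {n : ℕ} → QForm n → Prop
  | _, atom _ _ => True
  | _, bot => True
  | _, or φ ψ => QuantifierFree φ ∧ QuantifierFree ψ
  | _, and φ ψ => QuantifierFree φ ∧ QuantifierFree ψ
  | _, imp φ ψ => QuantifierFree φ ∧ QuantifierFree ψ
  | _, ex _ => False
  | _, all _ => False

end QForm

theorem PForm.toPForm_toQForm : ∀ φ : PForm, φ.toQForm.toPForm = φ
  | atom _ => rfl
  | bot => rfl
  | or φ ψ => by simp [toQForm, QForm.toPForm, toPForm_toQForm φ, toPForm_toQForm ψ]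
  | and φ ψ => by simp [toQForm, QForm.toPForm, toPForm_toQForm φ, toPForm_toQForm ψ]
  | imp φ ψ => by simp [toQForm, QForm.toPForm, toPForm_toQForm φ, toPForm_toQForm ψ]

theorem PForm.quantifierFree_toQForm : ∀ φ : PForm, φ.toQForm.QuantifierFree
  | atom _ => trivial
  | bot => trivial
  | or φ ψ => ⟨φ.quantifierFree_toQForm, ψ.quantifierFree_toQForm⟩
  | and φ ψ => ⟨φ.quantifierFree_toQForm, ψ.quantifierFree_toQForm⟩
  | imp φ ψ => ⟨φ.quantifierFree_toQForm, ψ.quantifierFree_toQForm⟩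

/-- Propositional components as first-order components with the empty signature. -/
def embed : Multiset (Pol PForm) →+ Multiset ℕ × Multiset (Pol (QForm 0)) :=
  (AddMonoidHom.inr _ _).comp (Multiset.mapAddMonoidHom (Pol.map PForm.toQForm))

/-- First-order components as propositional ones, without the signature and the arguments of
the atoms. -/
def forget : Multiset ℕ × Multiset (Pol (QForm 0)) →+ Multiset (Pol PForm) :=
  (Multiset.mapAddMonoidHom (Pol.map QForm.toPForm)).comp (AddMonoidHom.snd _ _)

theorem embed_apply (Γ : Multiset (Pol PForm)) : embed Γ = (0, Γ.map (Pol.map PForm.toQForm)) :=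
  rfl

theorem forget_apply (d : Multiset ℕ × Multiset (Pol (QForm 0))) :
    forget d = d.2.map (Pol.map QForm.toPForm) :=
  rfl

theorem forget_embed (Γ : Multiset (Pol PForm)) : forget (embed Γ) = Γ := by
  have : Pol.map QForm.toPForm ∘ Pol.map PForm.toQForm = id := by
    funext A
    cases A <;> simp [Pol.map, PForm.toPForm_toQForm]
  rw [embed_apply, forget_apply, Multiset.map_map, this, Multiset.map_id]

theorem derivable_embed {L : Dom} {C : PSeq} (h : Derivable (RuleSet.extend NI CutI) C) :
    Derivable (RuleSet.extend (NQ L) CutQ) (C.map embed) := by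
  induction h with
  | @step Ps C rule _ ih =>
    refine Derivable.step (Ps := Ps.map (NSeq.map embed)) ?_ ?_
    · rcases rule with rule | rule
      · cases rule <;> left <;>
          simp only [List.map_cons, List.map_nil, NSeq.map_put, NSeq.map_nest, embed_apply,
            Multiset.map_singleton, Multiset.insert_eq_cons, Multiset.map_cons, Pol.map,
            PForm.toQForm]
        case id S w u hwu p _ => exact .id (S.map embed) hwu p _
        case botIn S w hw _ => exact .botIn (S.map embed) hw
        case orIn S w hw φ ψ _ => exact .orIn (S.map embed) hw _ _
        case orOut S w hw φ ψ _ => exact .orOut (S.map embed) hw _ _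
        case andIn S w hw φ ψ _ => exact .andIn (S.map embed) hw _ _
        case andOut S w hw φ ψ _ => exact .andOut (S.map embed) hw _ _
        case impIn S w u hwu φ ψ _ => exact .impIn (S.map embed) hwu _ _
        case impOut S w u hw hu φ ψ _ => exact .impOut (S.map embed) hw hu _ _
      · right
        cases rule with
        | cut S hw φ =>
          simp only [List.map_cons, List.map_nil, NSeq.map_put, embed_apply,
            Multiset.map_singleton, Pol.map]
          exact .cut (NSeq.map embed _) hw _
    · intro P hP
      obtain ⟨Q, hQ, rfl⟩ := List.mem_map.1 hP
      exact ih Q hQ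

/-- The formula of a polarized formula contains no quantifiers. -/
def Pol.QuantifierFree : Pol (QForm 0) → Prop
  | .inp φ => φ.QuantifierFree
  | .out φ => φ.QuantifierFree

/-- No component contains a quantifier. -/
def QSeq.QuantifierFree (S : QSeq) : Prop :=
  ∀ w, ∀ A ∈ (S.comp w).2, A.QuantifierFree

theorem QSeq.quantifierFree_put {S : QSeq} {w : ℕ} {d : Multiset ℕ × Multiset (Pol (QForm 0))} :
    QSeq.QuantifierFree (S.put w d) ↔ S.QuantifierFree ∧ ∀ A ∈ d.2, A.QuantifierFree := by
  constructor
  · intro h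
    exact ⟨fun v A hA => h v A (QSeq.mem_form_put.2 (.inl hA)),
      fun A hA => h w A (QSeq.mem_form_put.2 (.inr ⟨rfl, hA⟩))⟩
  · rintro ⟨h₁, h₂⟩ v A hA
    rcases QSeq.mem_form_put.1 hA with hA | ⟨-, hA⟩
    · exact h₁ v A hA
    · exact h₂ A hA

theorem QSeq.QuantifierFree.nest {S : QSeq} (h : S.QuantifierFree) {w u : ℕ} (hw : w ∈ S.labels)
    (hu : u ∉ S.labels) {d : Multiset ℕ × Multiset (Pol (QForm 0))}
    (hd : ∀ A ∈ d.2, A.QuantifierFree) : QSeq.QuantifierFree (S.nest w u hw hu d) := by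
  intro v A hA
  by_cases hv : v = u
  · subst hv
    exact hd A (by simpa [NSeq.nest] using hA)
  · exact h v A (by simpa [NSeq.nest, hv] using hA)

/-- A cut-free derivation of a quantifier-free sequent has the subformula property, so it is a
propositional derivation. -/
theorem derivable_forget {L : Dom} {C : QSeq} (h : Derivable (NQ L) C) (hC : C.QuantifierFree) :
    Derivable NI (C.map forget) := by
  induction h with
  | @step Ps C rule _ ih =>
    cases rule
    -- The conclusion and the premise of `ds` only differ in the signature, which is forgotten.
    case ds S w hw k p x _ =>
      have := ih _ (List.mem_singleton_self _)
        (QSeq.quantifierFree_put.2 (QSeq.quantifierFree_put (d := (0, _)).1 hC))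
      rw [NSeq.map_put] at this ⊢
      exact this
    -- This also discards the quantifier rules.
    all_goals
      simp only [QSeq.quantifierFree_put, Multiset.mem_singleton, forall_eq, Pol.QuantifierFree,
        QForm.QuantifierFree, and_false] at hC
    all_goals
      refine Derivable.step (Ps := List.map (NSeq.map forget) _) ?_ (fun P hP => by
        obtain ⟨Q, hQ, rfl⟩ := List.mem_map.1 hP
        refine ih Q hQ ?_
        clear ih
        simp only [List.mem_cons, List.not_mem_nil, or_false] at hQ <;>
        first
          | (subst hQ
             exact QSeq.QuantifierFree.nest hC.1 _ _ (by simpa [Pol.QuantifierFree] using hC.2))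
          | (rcases hQ with rfl | rfl <;>
              simp_all [QSeq.quantifierFree_put, Pol.QuantifierFree, QForm.QuantifierFree]))
    all_goals
      simp only [List.map_cons, List.map_nil, NSeq.map_put, NSeq.map_nest, forget_apply,
        Multiset.map_singleton, Multiset.insert_eq_cons, Multiset.map_cons, Pol.map,
        QForm.toPForm, QForm.pred]
    case id S w u hwu k p x _ => exact .id (S.map forget) hwu p
    case botIn S w hw _ => exact .botIn (S.map forget) hw
    case orIn S w hw φ ψ _ => exact .orIn (S.map forget) hw _ _
    case orOut S w hw φ ψ _ => exact .orOut (S.map forget) hw _ _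
    case andIn S w hw φ ψ _ => exact .andIn (S.map forget) hw _ _
    case andOut S w hw φ ψ _ => exact .andOut (S.map forget) hw _ _
    case impIn S w u hwu φ ψ _ => exact .impIn (S.map forget) hwu _ _
    case impOut S w u hw hu φ ψ _ => exact .impOut (S.map forget) hw hu _ _

theorem eliminable_cutI : Eliminable CutI NI := by
  intro C hC
  have hqf : QSeq.QuantifierFree (C.map embed) := by
    intro w A hA
    obtain ⟨B, -, rfl⟩ := Multiset.mem_map.1 (by simpa [NSeq.map, embed_apply] using hA)
    cases B <;> exact PForm.quantifierFree_toQForm _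
  have h := derivable_forget (eliminable_cutQ .CD _ (derivable_embed hC)) hqf
  have hmap : (C.map embed).map forget = C := by
    simp [NSeq.map, forget_embed]
  rwa [hmap] at h

theorem mainTheorem4 :
    Eliminable CutI NI ∧ Eliminable CutQ (NQ .ND) ∧ Eliminable CutQ (NQ .CD) :=
  ⟨eliminable_cutI, eliminable_cutQ .ND, eliminable_cutQ .CD⟩
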